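/- Let $\mathcal G=(\mathcal E,\mathcal V)$ be a compact metric graph, i.e. a connected metric graph with finitely many edges $e$, each identified with an interval $[0,\ell_e]$ of finite length $\ell_e>0$ (loops and multiple edges are allowed). Let $H^1(\mathcal G)$ be the space of continuous functions $u:\mathcal G\to\mathbb R$ whose restriction $u_e$ to every edge $e$ belongs to $H^1(0,\ell_e)$. Let $p>2$ and let $W,\rho\in L^\infty(\mathcal G)$ with $\operatorname{ess\,inf}_{\mathcal G}\rho>0$. For $\lambda\in\mathbb R$, consider the problem $$-u''+W(x)u+\lambda u=\rho(x)|u|^{p-2}u\quad\text{on every edge,}\qquad u \text{ continuous on }\mathcal G,\qquad \sum_{e\succ v}\frac{du_e}{dx}(v)=0\ \text{ at every vertex } v, \tag{1}$$ where the derivatives at $v$ are taken in the direction away from $v$. A pair $(\lambda,u)\in\mathbb R\times H^1(\mathcal G)$ is a solution of (1) if $$\int_{\mathcal G}\bigl(u'\varphi'+(W+\lambda)u\varphi\bigr)\,dx=\int_{\mathcal G}\rho|u|^{p-2}u\,\varphi\,dx\qquad\text{for all }\varphi\in H^1(\mathcal G).$$ The Morse index $m(u)\in\{0,1,2,\dots\}\cup\{+\infty\}$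 of such a solution is the largest dimension of a linear subspace $X\subset H^1(\mathcal G)$ such that $$\int_{\mathcal G}\bigl(|\varphi'|^2+(W+\lambda)|\varphi|^2-(p-1)\rho|u|^{p-2}|\varphi|^2\bigr)\,dx<0\qquad\text{for all }\varphi\in X\setminus\{0\},$$ or $+\infty$ if there is no largest such dimension. Let $\Lambda\in(0,+\infty)$ and let $\mathcal U\subseteq[-\Lambda,\Lambda]\times H^1(\mathcal G)$ be a set of solutions of (1). Then for every $(\lambda,u)\in\mathcal U$ the function $u$ is of class $C^1$ on every closed edge and has finite Morse index, and $$\sup_{(\lambda,u)\in\mathcal U}\|u\|_{L^\infty(\mathcal G)}<+\infty\iff\sup_{(\lambda,u)\in\mathcal U}\ \sup_{e\in\mathcal E}\|u\|_{C^1(e)}<+\infty\iff\sup_{(\lambda,u)\in\mathcal U}m(u)<+\infty,$$ where $\|u\|_{C^1(e)}=\max_{e}|u_e|+\max_e|u_e'|$. -/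

import Mathlib

open MeasureTheory Set
open scoped ENNReal ContDiff

noncomputable section

/-- A connected metric graph, all of whose edges have finite length. The edge `e` is identified
with the interval `[0, len e]`, the end `0` lying at the vertex `src e` and the end `len e` at the
vertex `tgt e`. Loops (`src e = tgt e`) and multiple edges are allowed. The graph is compact
when the type `E` of edges is finite. -/
structure MetricGraph (V E : Type*) where
  src : E → V
  tgt : E → V
  len : E → ℝ
  len_pos : ∀ e, 0 < len e
  nonempty : Nonempty V
  connected : ∀ v w : V, Relation.EqvGen (fun a b => ∃ e, src e = a ∧ tgt e = b) v w

/-- `g` is a weak derivative of `f` on the open interval `(0, l)`. -/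
def IsWeakDeriv (l : ℝ) (f g : ℝ → ℝ) : Prop :=
  ∀ η : ℝ → ℝ, ContDiff ℝ ∞ η → HasCompactSupport η → tsupport η ⊆ Ioo 0 l →
    ∫ x in Ioo 0 l, f x * deriv η x = -∫ x in Ioo 0 l, g x * η x

lemma integrableOn_mul_test {l : ℝ} {g η : ℝ → ℝ} (hg : MemLp g 2 (volume.restrict (Ioo 0 l)))
    (hη : Continuous η) (hc : HasCompactSupport η) :
    Integrable (fun x => g x * η x) (volume.restrict (Ioo 0 l)) :=
  MemLp.integrable_mul (p := 2) (q := 2) hg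
    ((hη.memLp_of_hasCompactSupport hc).restrict _)

lemma integrableOn_mul_deriv_test {l : ℝ} {f η : ℝ → ℝ} (hf : Continuous f)
    (hη : ContDiff ℝ ∞ η) (hc : HasCompactSupport η) :
    Integrable (fun x => f x * deriv η x) (volume.restrict (Ioo 0 l)) :=
  ((hf.mul (hη.continuous_deriv (by simp))).integrable_of_hasCompactSupport
    hc.deriv.mul_left).integrableOn

/-- A weak derivative in `L²` is unique up to null sets. -/
lemma IsWeakDeriv.ae_unique {l : ℝ} {f g₁ g₂ : ℝ → ℝ}
    (hg₁ : MemLp g₁ 2 (volume.restrict (Ioo 0 l))) (hg₂ : MemLp g₂ 2 (volume.restrict (Ioo 0 l)))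
    (h₁ : IsWeakDeriv l f g₁) (h₂ : IsWeakDeriv l f g₂) :
    g₁ =ᵐ[volume.restrict (Ioo 0 l)] g₂ := by
  have hi : IntegrableOn (fun x => g₁ x - g₂ x) (Ioo 0 l) :=
    (hg₁.sub hg₂).integrable (by norm_num)
  have key := isOpen_Ioo.ae_eq_zero_of_integral_contDiff_smul_eq_zero
    hi.locallyIntegrableOn (fun η hη hc hs => by
      have e : ∫ x in Ioo 0 l, η x • (g₁ x - g₂ x) = 0 := by
        have := (h₁ η hη hc hs).symm.trans (h₂ η hη hc hs)
        have e2 : (fun x => η x • (g₁ x - g₂ x)) = fun x => g₁ x * η x - g₂ x * η x := by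
          ext x; simp only [smul_eq_mul]; ring
        rw [e2, integral_sub (integrableOn_mul_test hg₁ hη.continuous hc)
          (integrableOn_mul_test hg₂ hη.continuous hc)]
        linarith
      rw [← e]
      refine (setIntegral_eq_integral_of_forall_compl_eq_zero fun x hx => ?_).symm
      have : η x = 0 := image_eq_zero_of_notMem_tsupport fun h => hx (hs h)
      simp [this])
  rw [Filter.EventuallyEq, ae_restrict_iff' measurableSet_Ioo]
  filter_upwards [key] with x hx hmem
  exact sub_eq_zero.mp (hx hmem)

namespace MetricGraph

variable {V E : Type*} (G : MetricGraph V E)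

/-- Vectors `(u_e)` of functions, with `u_e` continuous on the closed edge `[0, len e]`. -/
abbrev EdgeFun : Type _ := ∀ e : E, C(Icc (0 : ℝ) (G.len e), ℝ)

variable {G} in
/-- The component `u_e` as a function of a real variable, extended by constants outside
`[0, len e]`. -/
def EdgeFun.onEdge (u : G.EdgeFun) (e : E) : ℝ → ℝ :=
  IccExtend (G.len_pos e).le (u e)

lemma EdgeFun.continuous_onEdge (u : G.EdgeFun) (e : E) : Continuous (u.onEdge e) :=
  (u e).continuous.Icc_extend'

/-- The space `H¹(G)`: the functions that are continuous on `G` (the components at a vertex `v`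
share the value `c v`) and that have on every edge a weak derivative in `L²`. (On a graph with
finitely many edges the `H¹` norm is then finite.) -/
def H1 : Submodule ℝ G.EdgeFun where
  carrier := {u | (∃ c : V → ℝ, ∀ e, u.onEdge e 0 = c (G.src e) ∧
      u.onEdge e (G.len e) = c (G.tgt e)) ∧
    ∀ e, ∃ g : ℝ → ℝ, MemLp g 2 (volume.restrict (Ioo 0 (G.len e))) ∧
      IsWeakDeriv (G.len e) (u.onEdge e) g}
  zero_mem' := ⟨⟨0, fun e => by simp [EdgeFun.onEdge, IccExtend]⟩, fun e => ⟨0, MemLp.zero',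
    fun η _ _ _ => by simp [EdgeFun.onEdge, IccExtend]⟩⟩
  add_mem' := by
    rintro u v ⟨⟨c, hc⟩, hu⟩ ⟨⟨d, hd⟩, hv⟩
    have hadd : ∀ e x, EdgeFun.onEdge (u + v) e x = u.onEdge e x + v.onEdge e x :=
      fun e x => by simp [EdgeFun.onEdge, IccExtend]
    refine ⟨⟨c + d, fun e => ?_⟩, fun e => ?_⟩
    · simp [hadd, (hc e).1, (hc e).2, (hd e).1, (hd e).2]
    · obtain ⟨g, hg, hg'⟩ := hu e
      obtain ⟨h, hh, hh'⟩ := hv e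
      refine ⟨g + h, hg.add hh, fun η hη hcη hs => ?_⟩
      simp only [hadd, Pi.add_apply, add_mul]
      rw [integral_add (integrableOn_mul_deriv_test (u.continuous_onEdge G e) hη hcη)
          (integrableOn_mul_deriv_test (v.continuous_onEdge G e) hη hcη),
        integral_add (integrableOn_mul_test hg hη.continuous hcη)
          (integrableOn_mul_test hh hη.continuous hcη), hg' η hη hcη hs, hh' η hη hcη hs]
      ring
  smul_mem' := by
    rintro a u ⟨⟨c, hc⟩, hu⟩
    have hsmul : ∀ e x, EdgeFun.onEdge (a • u) e x = a * u.onEdge e x :=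
      fun e x => by simp [EdgeFun.onEdge, IccExtend]
    refine ⟨⟨a • c, fun e => ?_⟩, fun e => ?_⟩
    · simp [hsmul, (hc e).1, (hc e).2]
    · obtain ⟨g, hg, hg'⟩ := hu e
      refine ⟨a • g, hg.const_smul a, fun η hη hcη hs => ?_⟩
      simp only [hsmul, Pi.smul_apply, smul_eq_mul, mul_assoc]
      rw [integral_const_mul, integral_const_mul, hg' η hη hcη hs]
      ring

variable {G}

/-- The component `u_e` of `u ∈ H¹(G)`. -/
def fn (u : G.H1) (e : E) : ℝ → ℝ := EdgeFun.onEdge u.1 e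

/-- The weak derivative of `u_e` on `(0, len e)`; it is unique up to null sets. -/
def weakDeriv (u : G.H1) (e : E) : ℝ → ℝ := Classical.choose (u.2.2 e)

lemma weakDeriv_spec (u : G.H1) (e : E) :
    MemLp (weakDeriv u e) 2 (volume.restrict (Ioo 0 (G.len e))) ∧
      IsWeakDeriv (G.len e) (fn u e) (weakDeriv u e) :=
  Classical.choose_spec (u.2.2 e)

/-- The norm of `u` in `L^∞(G)` (an essential supremum). -/
def normLinfty (u : G.H1) : ℝ≥0∞ :=
  ⨆ e, eLpNorm (fn u e) ∞ (volume.restrict (Ioo 0 (G.len e)))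

/-- The norm `max |u| + max |u'|` on the closed edge `e`, for `u` of class `C¹` on that edge. -/
def normC1 (u : G.H1) (e : E) : ℝ≥0∞ :=
  (⨆ x ∈ Icc 0 (G.len e), ‖fn u e x‖ₑ) +
    ⨆ x ∈ Icc 0 (G.len e), ‖derivWithin (fn u e) (Icc 0 (G.len e)) x‖ₑ

variable [Fintype E]

/-- `u ∈ H¹(G)` is a solution of `-u'' + W u + lam u = ρ |u|^(p-2) u` on `G` with the Kirchhoff
conditions at the vertices, in the weak sense. (As `G` is compact, every function in `H¹(G)` has
compact support.) -/
def IsSolution (p : ℝ) (W ρ : E → ℝ → ℝ) (lam : ℝ) (u : G.H1) : Prop :=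
  ∀ φ : G.H1,
    ∑ e, ∫ x in Ioo 0 (G.len e),
        (weakDeriv u e x * weakDeriv φ e x + (W e x + lam) * fn u e x * fn φ e x) =
      ∑ e, ∫ x in Ioo 0 (G.len e), ρ e x * |fn u e x| ^ (p - 2) * fn u e x * fn φ e x

/-- The quadratic form of the linearisation of the equation at `u`. -/
def quadForm (p : ℝ) (W ρ : E → ℝ → ℝ) (lam : ℝ) (u φ : G.H1) : ℝ :=
  ∑ e, ∫ x in Ioo 0 (G.len e),
    (weakDeriv φ e x ^ 2 + (W e x + lam) * fn φ e x ^ 2 -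
      (p - 1) * ρ e x * |fn u e x| ^ (p - 2) * fn φ e x ^ 2)

/-- The Morse index of `u`: the largest dimension of a subspace of `H¹(G)` on which the quadratic
form is negative definite, or `⊤` if these dimensions are unbounded. -/
def morseIndex (p : ℝ) (W ρ : E → ℝ → ℝ) (lam : ℝ) (u : G.H1) : ℕ∞ :=
  ⨆ (X : Submodule ℝ G.H1)
    (_ : FiniteDimensional ℝ X ∧ ∀ φ ∈ X, φ ≠ 0 → quadForm p W ρ lam u φ < 0),
    (Module.finrank ℝ X : ℕ∞)

end MetricGraph

end

open MeasureTheory Set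
open scoped ENNReal ContDiff

noncomputable section

/-- A smooth function with integral zero and compact support in `(0, l)` is the derivative of a
smooth function with compact support in `(0, l)`. -/
lemma exists_primitive_of_integral_eq_zero {l : ℝ} {ζ : ℝ → ℝ} (hζ : ContDiff ℝ ∞ ζ)
    (hc : HasCompactSupport ζ) (hs : tsupport ζ ⊆ Ioo 0 l) (h0 : ∫ x, ζ x = 0) :
    ∃ η : ℝ → ℝ, ContDiff ℝ ∞ η ∧ HasCompactSupport η ∧ tsupport η ⊆ Ioo 0 l ∧
      deriv η = ζ := by
  have hd : ∀ x, HasDerivAt (fun x => ∫ t in (0 : ℝ)..x, ζ t) (ζ x) x := fun x =>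
    intervalIntegral.integral_hasDerivAt_right (hζ.continuous.intervalIntegrable _ _)
      (hζ.continuous.stronglyMeasurableAtFilter _ _) hζ.continuous.continuousAt
  have hdz : deriv (fun x => ∫ t in (0 : ℝ)..x, ζ t) = ζ := funext fun x => (hd x).deriv
  obtain ⟨a, b, hab, hKab⟩ : ∃ a b, Icc a b ⊆ Ioo 0 l ∧ tsupport ζ ⊆ Icc a b := by
    rcases (tsupport ζ).eq_empty_or_nonempty with h | h
    · exact ⟨1, 0, by simp, by simp [h]⟩
    · refine ⟨sInf (tsupport ζ), sSup (tsupport ζ), ?_, fun x hx =>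
        ⟨csInf_le hc.isCompact.bddBelow hx, le_csSup hc.isCompact.bddAbove hx⟩⟩
      exact fun x hx => ⟨(hs (hc.isCompact.sInf_mem h)).1.trans_le hx.1,
        hx.2.trans_lt (hs (hc.isCompact.sSup_mem h)).2⟩
  have hz : ∀ x, x ∉ Icc a b → ζ x = 0 := fun x hx =>
    image_eq_zero_of_notMem_tsupport fun h => hx (hKab h)
  have hz0 : ∀ x, x ≤ 0 → ζ x = 0 := fun x hx => hz x fun h => (hab h).1.not_ge hx
  have hηa : ∀ x, x ∉ Icc a b → ∫ t in (0 : ℝ)..x, ζ t = 0 := by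
    intro x hx
    rw [mem_Icc, not_and_or, not_le, not_le] at hx
    rcases hx with hx | hx
    · refine (intervalIntegral.integral_congr_ae (g := fun _ => 0) ?_).trans (by simp)
      refine .of_forall fun t ht => ?_
      rw [mem_uIoc] at ht
      rcases ht with ht | ht
      · exact hz t fun h => by linarith [h.1, ht.2]
      · exact hz0 t ht.2
    · by_cases hx0 : 0 ≤ x
      · rw [intervalIntegral.integral_of_le hx0]
        refine Eq.trans ?_ h0
        refine setIntegral_eq_integral_of_forall_compl_eq_zero fun t ht => ?_
        rw [mem_Ioc, not_and_or, not_lt, not_le] at ht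
        rcases ht with ht | ht
        · exact hz0 t ht
        · exact hz t fun h => by linarith [h.2]
      · refine (intervalIntegral.integral_congr_ae (g := fun _ => 0) ?_).trans (by simp)
        refine .of_forall fun t ht => ?_
        rw [uIoc_of_ge (by linarith)] at ht
        exact hz0 t ht.2
  have hts : tsupport (fun x => ∫ t in (0 : ℝ)..x, ζ t) ⊆ Icc a b := by
    refine closure_minimal (fun x hx => ?_) isClosed_Icc
    by_contra h
    exact hx (hηa x h)
  refine ⟨fun x => ∫ t in (0 : ℝ)..x, ζ t, ?_, ?_, hts.trans hab, hdz⟩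
  · rw [contDiff_infty_iff_deriv, hdz]
    exact ⟨fun x => (hd x).differentiableAt, hζ⟩
  · exact isCompact_Icc.of_isClosed_subset (isClosed_tsupport _) hts

/-- The du Bois-Reymond lemma. -/
lemma ae_eq_const_of_integral_mul_deriv_eq_zero {l : ℝ} (hl : 0 < l) {w : ℝ → ℝ}
    (hw : IntegrableOn w (Ioo 0 l))
    (h : ∀ η : ℝ → ℝ, ContDiff ℝ ∞ η → HasCompactSupport η → tsupport η ⊆ Ioo 0 l →
      ∫ x in Ioo 0 l, w x * deriv η x = 0) :
    ∃ c : ℝ, ∀ᵐ x ∂(volume.restrict (Ioo 0 l)), w x = c := by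
  let B : ContDiffBump (l / 2) := ⟨l / 8, l / 4, by positivity, by linarith⟩
  set ψ₀ : ℝ → ℝ := B.normed volume with hψ₀
  have hψc : ContDiff ℝ ∞ ψ₀ := B.contDiff_normed
  have hψs : HasCompactSupport ψ₀ := B.hasCompactSupport_normed
  have hψt : tsupport ψ₀ ⊆ Ioo 0 l := by
    rw [hψ₀, B.tsupport_normed_eq, Real.closedBall_eq_Icc]
    exact fun x hx => ⟨by have := hx.1; simp only [B] at this; linarith,
      by have := hx.2; simp only [B] at this; linarith⟩
  have hψ1 : ∫ x, ψ₀ x = 1 := B.integral_normed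
  have hint : ∀ {ψ : ℝ → ℝ}, ContDiff ℝ ∞ ψ → HasCompactSupport ψ →
      IntegrableOn (fun x => w x * ψ x) (Ioo 0 l) := fun {ψ} hψ hc => by
    obtain ⟨C, hC⟩ := hc.exists_bound_of_continuous hψ.continuous
    exact hw.mul_bdd hψ.continuous.aestronglyMeasurable (.of_forall hC)
  set c := ∫ x in Ioo 0 l, w x * ψ₀ x
  refine ⟨c, ?_⟩
  have hwc : IntegrableOn (fun x => w x - c) (Ioo 0 l) :=
    hw.sub (integrableOn_const (by simp))
  have key := isOpen_Ioo.ae_eq_zero_of_integral_contDiff_smul_eq_zero (μ := volume)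
    hwc.locallyIntegrableOn (fun ψ hψ hc hs => by
      obtain ⟨η, h1, h2, h3, h4⟩ := exists_primitive_of_integral_eq_zero (l := l)
        (ζ := fun x => ψ x - (∫ t, ψ t) * ψ₀ x) (hψ.sub (contDiff_const.mul hψc))
        (hc.sub hψs.mul_left)
        ((tsupport_sub _ _).trans (union_subset hs ((tsupport_mul_subset_right).trans hψt)))
        (by rw [integral_sub (hψ.continuous.integrable_of_hasCompactSupport hc)
              ((hψc.continuous.integrable_of_hasCompactSupport hψs).const_mul _),
              integral_const_mul, hψ1]; ring)
      have := h η h1 h2 h3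
      rw [h4] at this
      have e1 : ∫ x, ψ x • (w x - c) = ∫ x in Ioo 0 l, ψ x • (w x - c) := by
        refine (setIntegral_eq_integral_of_forall_compl_eq_zero fun x hx => ?_).symm
        rw [image_eq_zero_of_notMem_tsupport fun h => hx (hs h), zero_smul]
      have e2 : ∫ x in Ioo 0 l, ψ x = ∫ x, ψ x := by
        refine setIntegral_eq_integral_of_forall_compl_eq_zero fun x hx => ?_
        exact image_eq_zero_of_notMem_tsupport fun h => hx (hs h)
      have e3 : ∫ x in Ioo 0 l, w x * (ψ x - (∫ t, ψ t) * ψ₀ x) =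
          (∫ x in Ioo 0 l, w x * ψ x) - (∫ t, ψ t) * c := by
        rw [← integral_const_mul, ← integral_sub (hint hψ hc) ((hint hψc hψs).const_mul _)]
        congr 1; ext x; ring
      have e4 : ∫ x in Ioo 0 l, ψ x • (w x - c) =
          (∫ x in Ioo 0 l, w x * ψ x) - (∫ t, ψ t) * c := by
        rw [← e2, ← integral_mul_const, ← integral_sub (hint hψ hc)
          ((hψ.continuous.integrable_of_hasCompactSupport hc).integrableOn.mul_const _)]
        congr 1; ext x; simp only [smul_eq_mul]; ring
      rw [e1, e4, ← e3, this])
  rw [ae_restrict_iff' measurableSet_Ioo]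
  filter_upwards [key] with x hx hmem
  exact sub_eq_zero.mp (hx hmem)

lemma integral_Ioo_eq_intervalIntegral {l : ℝ} (hl : 0 ≤ l) (f : ℝ → ℝ) :
    ∫ x in Ioo 0 l, f x = ∫ x in (0 : ℝ)..l, f x := by
  rw [intervalIntegral.integral_of_le hl, integral_Ioc_eq_integral_Ioo]

lemma intervalIntegrable_of_integrableOn_Ioo {l : ℝ} {g : ℝ → ℝ} (hg : IntegrableOn g (Ioo 0 l))
    {x y : ℝ} (hx : x ∈ Icc 0 l) (hy : y ∈ Icc 0 l) : IntervalIntegrable g volume x y := by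
  have : IntegrableOn g (Icc 0 l) := by
    rwa [integrableOn_Icc_iff_integrableOn_Ioo]
  exact (this.mono_set (uIcc_subset_Icc hx hy)).intervalIntegrable

lemma continuousOn_primitive_Icc {l : ℝ} {g : ℝ → ℝ} (hl : 0 ≤ l)
    (hg : IntegrableOn g (Ioo 0 l)) :
    ContinuousOn (fun x => ∫ t in (0 : ℝ)..x, g t) (Icc 0 l) := by
  have := intervalIntegral.continuousOn_primitive_interval (a := 0) (b := l) (f := g)
    (μ := volume) (by rwa [uIcc_of_le hl, integrableOn_Icc_iff_integrableOn_Ioo])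
  rwa [uIcc_of_le hl] at this

/-- A primitive has the original function as its weak derivative. -/
lemma isWeakDeriv_of_eq_primitive {l : ℝ} (hl : 0 < l) {f g : ℝ → ℝ} {c : ℝ}
    (hg : IntegrableOn g (Ioo 0 l)) (hf : ∀ x ∈ Ioo 0 l, f x = c + ∫ t in (0 : ℝ)..x, g t) :
    IsWeakDeriv l f g := by
  intro η hη hc hs
  have hgi : IntervalIntegrable g volume 0 l :=
    intervalIntegrable_of_integrableOn_Ioo hg ⟨le_rfl, hl.le⟩ ⟨hl.le, le_rfl⟩
  have hac : AbsolutelyContinuousOnInterval (fun x => ∫ t in (0 : ℝ)..x, g t) 0 l :=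
    hgi.absolutelyContinuousOnInterval_intervalIntegral (by simp)
  have hηac : AbsolutelyContinuousOnInterval η 0 l :=
    (hη.of_le (by simp)).contDiffOn.absolutelyContinuousOnInterval
  have h0 : η 0 = 0 := image_eq_zero_of_notMem_tsupport fun h => (hs h).1.ne rfl
  have h1 : η l = 0 := image_eq_zero_of_notMem_tsupport fun h => (hs h).2.ne rfl
  have hη' : Continuous (deriv η) := hη.continuous_deriv (by simp)
  have e1 : ∫ x in Ioo 0 l, f x * deriv η x =
      ∫ x in Ioo 0 l, (c * deriv η x + (∫ t in (0 : ℝ)..x, g t) * deriv η x) := by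
    refine setIntegral_congr_fun measurableSet_Ioo fun x hx => ?_
    simp only [hf x hx]; ring
  rw [e1, integral_Ioo_eq_intervalIntegral hl.le, integral_Ioo_eq_intervalIntegral hl.le,
    intervalIntegral.integral_add ((hη'.intervalIntegrable _ _).const_mul c),
    intervalIntegral.integral_const_mul, intervalIntegral.integral_deriv_eq_sub
      (fun x _ => (hη.differentiable (by simp)) x) (hη'.intervalIntegrable _ _),
    hac.integral_mul_deriv_eq_deriv_mul hηac, h0, h1]
  · simp only [mul_zero, sub_zero, zero_sub, zero_add]
    congr 1
    refine intervalIntegral.integral_congr_ae ?_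
    filter_upwards [hgi.ae_hasDerivAt_integral] with x hx hmem
    rw [(hx (uIoc_subset_uIcc hmem) 0 (by simp)).deriv]
  · exact (hη'.intervalIntegrable _ _).continuousOn_mul hac.continuousOn

lemma IsWeakDeriv.exists_ae_eq_primitive {l : ℝ} (hl : 0 < l) {f g : ℝ → ℝ}
    (hf : IntegrableOn f (Ioo 0 l)) (hg : IntegrableOn g (Ioo 0 l)) (h : IsWeakDeriv l f g) :
    ∃ c : ℝ, ∀ᵐ x ∂(volume.restrict (Ioo 0 l)), f x = c + ∫ t in (0 : ℝ)..x, g t := by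
  have hP : IntegrableOn (fun x => ∫ t in (0 : ℝ)..x, g t) (Ioo 0 l) :=
    ((continuousOn_primitive_Icc hl.le hg).integrableOn_compact isCompact_Icc).mono_set
      Ioo_subset_Icc_self
  obtain ⟨c, hc⟩ := ae_eq_const_of_integral_mul_deriv_eq_zero hl (hf.sub hP)
    (fun η hη hcη hs => by
      obtain ⟨C, hC⟩ := hcη.deriv.exists_bound_of_continuous (hη.continuous_deriv (by simp))
      have hm := (hη.continuous_deriv (by simp)).aestronglyMeasurable
        (μ := volume.restrict (Ioo 0 l))
      simp only [Pi.sub_apply, sub_mul]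
      rw [integral_sub (hf.mul_bdd hm (.of_forall hC)) (hP.mul_bdd hm (.of_forall hC)),
        h η hη hcη hs,
        isWeakDeriv_of_eq_primitive (c := 0) hl hg (fun x _ => (zero_add _).symm) η hη hcη hs,
        sub_self])
  refine ⟨c, hc.mono fun x hx => ?_⟩
  simp only [Pi.sub_apply] at hx
  linarith

/-- A continuous function is the primitive of its weak derivative. -/
lemma IsWeakDeriv.eq_primitive {l : ℝ} (hl : 0 < l) {f g : ℝ → ℝ} (hf : ContinuousOn f (Icc 0 l))
    (hg : IntegrableOn g (Ioo 0 l)) (h : IsWeakDeriv l f g) {x : ℝ} (hx : x ∈ Icc 0 l) :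
    f x = f 0 + ∫ t in (0 : ℝ)..x, g t := by
  obtain ⟨c, hc⟩ := h.exists_ae_eq_primitive hl
    ((hf.integrableOn_compact isCompact_Icc).mono_set Ioo_subset_Icc_self) hg
  have key : EqOn f (fun x => c + ∫ t in (0 : ℝ)..x, g t) (Icc 0 l) := by
    refine Measure.eqOn_Icc_of_ae_eq volume hl.ne ?_ hf
      (continuousOn_const.add (continuousOn_primitive_Icc hl.le hg))
    rwa [← restrict_Ioo_eq_restrict_Icc]
  have h0 : f 0 = c := by simpa using key (left_mem_Icc.mpr hl.le)
  rw [h0]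
  exact key hx

/-- A continuous function that starts below `c` and reaches `c` does so for a first time. -/
lemma exists_first_ge {F : ℝ → ℝ} {a b c : ℝ} (hF : ContinuousOn F (Icc a b))
    (ha : F a < c) (h : ∃ w ∈ Icc a b, c ≤ F w) :
    ∃ v ∈ Ioc a b, F v = c ∧ ∀ z ∈ Ico a v, F z < c := by
  obtain ⟨w, hw, hcw⟩ := h
  have hcl : IsCompact (Icc a b ∩ F ⁻¹' Ici c) :=
    isCompact_Icc.of_isClosed_subset
      (hF.preimage_isClosed_of_isClosed isClosed_Icc isClosed_Ici) inter_subset_left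
  obtain ⟨v, ⟨hv, hcv⟩, hmin⟩ := hcl.exists_isLeast ⟨w, hw, hcw⟩
  have hlt : ∀ z ∈ Ico a v, F z < c := fun z hz => by
    by_contra! hc
    exact (hmin ⟨⟨hz.1, hz.2.le.trans hv.2⟩, hc⟩).not_gt hz.2
  have hav : a < v := hv.1.lt_of_ne fun h => by
    rw [← h] at hcv
    exact ha.not_ge hcv
  refine ⟨v, ⟨hav, hv.2⟩, le_antisymm ?_ hcv, hlt⟩
  have hcont : ContinuousWithinAt F (Ico a v) v :=
    (hF v hv).mono fun z hz => ⟨hz.1, hz.2.le.trans hv.2⟩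
  have : v ∈ closure (Ico a v) := by
    rw [closure_Ico hav.ne]; exact right_mem_Icc.mpr hav.le
  have hne : (nhdsWithin v (Ico a v)).NeBot := mem_closure_iff_nhdsWithin_neBot.mp this
  exact le_of_tendsto hcont (eventually_nhdsWithin_of_forall fun z hz => (hlt z hz).le)

/-- On `[0, l]` the function `g` is the derivative of `f`, the increments of `g` are controlled by
the size of `f`, and the slope of `g` is at most `-κ f` where `f` is large (and symmetrically where
`-f` is large). -/
structure IsRestoringPair (l : ℝ) (C κ₀ : ℝ → ℝ) (f g : ℝ → ℝ) : Prop where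
  hasDeriv : ∀ x ∈ Icc 0 l, HasDerivWithinAt f (g x) (Icc 0 l) x
  cont : ContinuousOn g (Icc 0 l)
  abs_sub_le : ∀ R x y, 0 ≤ x → x ≤ y → y ≤ l → (∀ z ∈ Icc x y, |f z| ≤ R) →
    |g y - g x| ≤ C R * (y - x)
  sub_le : ∀ κ > 0, ∀ K ≥ κ₀ κ, ∀ x y, 0 ≤ x → x ≤ y → y ≤ l → (∀ z ∈ Icc x y, K ≤ f z) →
    g y - g x ≤ -(κ * K * (y - x))
  le_sub : ∀ κ > 0, ∀ K ≥ κ₀ κ, ∀ x y, 0 ≤ x → x ≤ y → y ≤ l → (∀ z ∈ Icc x y, K ≤ -f z) →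
    κ * K * (y - x) ≤ g y - g x

namespace IsRestoringPair

variable {l : ℝ} {C κ₀ : ℝ → ℝ} {f g : ℝ → ℝ}

lemma neg (h : IsRestoringPair l C κ₀ f g) :
    IsRestoringPair l C κ₀ (fun x => -f x) (fun x => -g x) where
  hasDeriv x hx := (h.hasDeriv x hx).neg
  cont := h.cont.neg
  abs_sub_le R x y hx hxy hy hR := by
    have := h.abs_sub_le R x y hx hxy hy fun z hz => by simpa using hR z hz
    rwa [← abs_neg, neg_sub, show g x - g y = -g y - -g x by ring] at this
  sub_le κ hκ K hK x y hx hxy hy hf := by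
    have := h.le_sub κ hκ K hK x y hx hxy hy hf
    linarith
  le_sub κ hκ K hK x y hx hxy hy hf := by
    have := h.sub_le κ hκ K hK x y hx hxy hy fun z hz => by simpa using hf z hz
    linarith

lemma reflect (h : IsRestoringPair l C κ₀ f g) :
    IsRestoringPair l C κ₀ (fun x => f (l - x)) (fun x => -g (l - x)) where
  hasDeriv x hx := by
    have hm : MapsTo (fun x => l - x) (Icc 0 l) (Icc 0 l) := fun z hz =>
      ⟨by linarith [hz.2], by linarith [hz.1]⟩
    have := (h.hasDeriv (l - x) (hm hx)).comp x
      (((hasDerivAt_id x).const_sub l).hasDerivWithinAt (s := Icc 0 l)) hm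
    simpa [Function.comp_def] using this
  cont := by
    refine (h.cont.comp (by fun_prop) ?_).neg
    exact fun z hz => ⟨by linarith [hz.2], by linarith [hz.1]⟩
  abs_sub_le R x y hx hxy hy hR := by
    have := h.abs_sub_le R (l - y) (l - x) (by linarith) (by linarith) (by linarith)
      fun z hz => by
        simpa using hR (l - z) ⟨by linarith [hz.2], by linarith [hz.1]⟩
    rwa [show l - x - (l - y) = y - x by ring,
      show g (l - x) - g (l - y) = -g (l - y) - -g (l - x) by ring] at this
  sub_le κ hκ K hK x y hx hxy hy hf := by
    have := h.sub_le κ hκ K hK (l - y) (l - x) (by linarith) (by linarith) (by linarith)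
      fun z hz => by
        simpa using hf (l - z) ⟨by linarith [hz.2], by linarith [hz.1]⟩
    rw [show l - x - (l - y) = y - x by ring] at this
    linarith
  le_sub κ hκ K hK x y hx hxy hy hf := by
    have := h.le_sub κ hκ K hK (l - y) (l - x) (by linarith) (by linarith) (by linarith)
      fun z hz => by
        simpa using hf (l - z) ⟨by linarith [hz.2], by linarith [hz.1]⟩
    rw [show l - x - (l - y) = y - x by ring] at this
    linarith

lemma continuousOn (h : IsRestoringPair l C κ₀ f g) : ContinuousOn f (Icc 0 l) :=
  fun x hx => (h.hasDeriv x hx).continuousWithinAt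

lemma exists_slope (h : IsRestoringPair l C κ₀ f g) {x y : ℝ} (hx : 0 ≤ x) (hxy : x < y)
    (hy : y ≤ l) : ∃ z ∈ Ioo x y, f y - f x = g z * (y - x) := by
  obtain ⟨z, hz, he⟩ := exists_hasDerivAt_eq_slope f g hxy
    (h.continuousOn.mono (Icc_subset_Icc hx hy))
    fun z hz => (h.hasDeriv z ⟨hx.trans hz.1.le, hz.2.le.trans hy⟩).hasDerivAt
      (Icc_mem_nhds (hx.trans_lt hz.1) (hz.2.trans_le hy))
  refine ⟨z, hz, ?_⟩
  rw [he, div_mul_cancel₀ _ (sub_pos.mpr hxy).ne']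

lemma false_of_ge_of_nonpos (h : IsRestoringPair l C κ₀ f g) {κ K m δ : ℝ} (hκ : 0 < κ)
    (hK : κ₀ κ ≤ K) (hK0 : 0 < K) (hδ : 0 < δ) (hκδ : 1 ≤ κ * δ ^ 2) (hm : 0 ≤ m)
    (hml : m + 2 * δ ≤ l) (hf : ∀ z ∈ Icc m (m + 2 * δ), K ≤ f z) (hg : g m ≤ 0) : False := by
  have hmono : ∀ x y, m ≤ x → x ≤ y → y ≤ m + 2 * δ → g y ≤ g x := fun x y h1 h2 h3 => by
    have h4 := h.sub_le κ hκ K hK x y (hm.trans h1) h2 (h3.trans hml)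
      fun z hz => hf z ⟨h1.trans hz.1, hz.2.trans h3⟩
    have : 0 ≤ κ * K * (y - x) := by
      have := sub_nonneg.mpr h2
      positivity
    linarith
  have hanti : ∀ x ∈ Icc m (m + δ), f (m + δ) ≤ f x := fun x hx => by
    rcases hx.2.eq_or_lt with e | hlt
    · rw [e]
    · obtain ⟨z, hz, he⟩ := h.exists_slope (hm.trans hx.1) hlt (by linarith)
      have h1 : g z ≤ 0 := (hmono m z le_rfl (hx.1.trans hz.1.le) (by linarith [hz.2])).trans hg
      nlinarith
  have hq := h.sub_le κ hκ (f (m + δ)) (hK.trans (hf _ ⟨by linarith, by linarith⟩)) m (m + δ)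
    hm (by linarith) (by linarith) hanti
  obtain ⟨z, hz, he⟩ := h.exists_slope (x := m + δ) (y := m + 2 * δ) (by linarith) (by linarith)
    hml
  have h1 : g z ≤ g (m + δ) := hmono _ _ (by linarith) hz.1.le hz.2.le
  have h2 := hf (m + δ) ⟨by linarith, by linarith⟩
  have h3 := hf (m + 2 * δ) ⟨by linarith, by linarith⟩
  have h4 : g z ≤ -(κ * f (m + δ) * δ) := by
    rw [add_sub_cancel_left] at hq; linarith
  have h5 : g z * δ ≤ -(κ * f (m + δ) * δ) * δ := by gcongr
  have h6 : f (m + δ) ≤ κ * δ ^ 2 * f (m + δ) := by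
    have : 0 < f (m + δ) := by linarith
    nlinarith
  have h7 : m + 2 * δ - (m + δ) = δ := by ring
  rw [h7] at he
  nlinarith

/-- `f` cannot stay large on a long interval. -/
lemma exists_lt (h : IsRestoringPair l C κ₀ f g) {κ K x δ : ℝ} (hκ : 0 < κ)
    (hK : κ₀ κ ≤ K) (hK0 : 0 < K) (hδ : 0 < δ) (hκδ : 16 ≤ κ * δ ^ 2) (hx : 0 ≤ x)
    (hxl : x + δ ≤ l) : ∃ z ∈ Icc x (x + δ), f z < K := by
  by_contra! hf
  have hκ' : 1 ≤ κ * (δ / 4) ^ 2 := by nlinarith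
  rcases le_total (g (x + δ / 2)) 0 with hg | hg
  · exact h.false_of_ge_of_nonpos hκ hK hK0 (m := x + δ / 2) (by positivity : 0 < δ / 4) hκ'
      (by linarith) (by linarith)
      (fun z hz => hf z ⟨by linarith [hz.1], by linarith [hz.2]⟩) hg
  · refine h.reflect.false_of_ge_of_nonpos hκ hK hK0 (m := l - (x + δ / 2))
      (by positivity : 0 < δ / 4) hκ' (by linarith) (by linarith)
      (fun z hz => hf _ ⟨by linarith [hz.2], by linarith [hz.1]⟩) ?_
    simpa using hg

/-- A large value of `f` is followed by a steep zero. -/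
lemma exists_zero_of_large (h : IsRestoringPair l C κ₀ f g) {κ K z δ T : ℝ} (hκ : 0 < κ)
    (hK : κ₀ κ ≤ K) (hK0 : 0 < K) (hδ : 0 < δ) (hκδ : 16 ≤ κ * δ ^ 2) (hC : 0 ≤ C K)
    (hT : 0 < T) (hTK : K ≤ T * δ) (hz : 0 ≤ z) (hzl : z + 2 * δ ≤ l)
    (hf : K + δ * (T + C K * δ) < f z) :
    ∃ x ∈ Ioc z (z + 2 * δ), f x = 0 ∧ T ≤ |g x| := by
  have hfK : K < f z := hf.trans' (by have : 0 < δ * (T + C K * δ) := by positivity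
                                      linarith)
  obtain ⟨w, hw, hfw⟩ := h.exists_lt hκ hK hK0 hδ hκδ hz (by linarith)
  obtain ⟨y, hy, hfy, hylt⟩ := exists_first_ge (F := fun x => -f x) (a := z) (b := z + δ) (c := -K)
    (h.continuousOn.neg.mono (Icc_subset_Icc hz (by linarith))) (by simpa using hfK)
    ⟨w, hw, by simpa using hfw.le⟩
  replace hfy : f y = K := neg_inj.mp hfy
  have hyge : ∀ x ∈ Icc z y, K ≤ f x := fun x hx => by
    rcases hx.2.eq_or_lt with e | hlt
    · rw [e, hfy]
    · simpa using (hylt x ⟨hx.1, hlt⟩).le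
  have hgy : g y < -(T + C K * δ) := by
    obtain ⟨w, hw, he⟩ := h.exists_slope hz hy.1 (by linarith [hy.2])
    have h1 := h.sub_le κ hκ K hK w y (hz.trans hw.1.le) hw.2.le (by linarith [hy.2])
      fun x hx => hyge x ⟨hw.1.le.trans hx.1, hx.2⟩
    have h2 : 0 ≤ κ * K * (y - w) := by
      have := sub_nonneg.mpr hw.2.le
      positivity
    have h3 : 0 < T + C K * δ := by positivity
    have h4 : g w < -(T + C K * δ) := by
      by_contra! h5
      nlinarith [hy.1, hy.2]
    linarith
  have hsteep : ∀ x ∈ Icc y (y + δ), (∀ s ∈ Icc y x, 0 ≤ f s) → g x < -T := by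
    intro x hx hpos
    by_contra! hgx
    have hCδ : 0 ≤ C K * δ := by positivity
    obtain ⟨v, hv, hgv, hvlt⟩ := exists_first_ge (F := g) (a := y) (b := x) (c := -T)
      (h.cont.mono (Icc_subset_Icc (by linarith [hy.1]) (by linarith [hx.2, hy.2])))
      (by linarith) ⟨x, ⟨hx.1, le_rfl⟩, hgx⟩
    have hle : ∀ s ∈ Icc y v, |f s| ≤ K := fun s hs => by
      rw [abs_of_nonneg (hpos s ⟨hs.1, hs.2.trans hv.2⟩)]
      rcases hs.1.eq_or_lt with e | hlt
      · rw [← e, hfy]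
      · obtain ⟨w, hw, he⟩ := h.exists_slope (by linarith [hy.1]) hlt
          (by linarith [hs.2, hv.2, hx.2, hy.2])
        have := hvlt w ⟨hw.1.le, hw.2.trans_le hs.2⟩
        nlinarith
    have h1 := h.abs_sub_le K y v (by linarith [hy.1]) hv.1.le
      (by linarith [hv.2, hx.2, hy.2]) hle
    have h2 : C K * (v - y) ≤ C K * δ := by
      gcongr; linarith [hv.2, hx.2]
    have := (abs_le.mp (h1.trans h2)).2
    linarith
  have hzero : ∃ w ∈ Icc y (y + δ), 0 ≤ -f w := by
    by_contra! hneg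
    have hpos : ∀ s ∈ Icc y (y + δ), 0 < f s := fun s hs => by simpa using hneg s hs
    obtain ⟨w, hw, he⟩ := h.exists_slope (x := y) (y := y + δ) (by linarith [hy.1])
      (by linarith) (by linarith [hy.2])
    have h1 := hsteep w ⟨hw.1.le, hw.2.le⟩ fun s hs => (hpos s ⟨hs.1, hs.2.trans hw.2.le⟩).le
    have h2 := hpos (y + δ) ⟨by linarith, le_rfl⟩
    rw [add_sub_cancel_left] at he
    nlinarith
  obtain ⟨x, hx, hfx, hxlt⟩ := exists_first_ge (F := fun x => -f x) (a := y) (b := y + δ) (c := 0)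
    (h.continuousOn.neg.mono (Icc_subset_Icc (by linarith [hy.1]) (by linarith [hy.2])))
    (by rw [hfy]; linarith) hzero
  replace hfx : f x = 0 := by simpa using hfx
  refine ⟨x, ⟨hy.1.trans hx.1, by linarith [hx.2, hy.2]⟩, hfx, ?_⟩
  have := hsteep x ⟨hx.1.le, hx.2⟩ fun s hs => by
    rcases hs.2.eq_or_lt with e | hlt
    · rw [e, hfx]
    · simpa using (hxlt s ⟨hs.1, hlt⟩).le
  rw [abs_of_neg (by linarith)]
  linarith

/-- If `f` or `g` is large at `x`, then `|f|` exceeds `R` soon after `x`. -/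
lemma exists_abs_gt (h : IsRestoringPair l C κ₀ f g) {R x δ : ℝ} (hδ : 0 < δ) (hx : 0 ≤ x)
    (hxl : x + δ ≤ l) (hA : max R (2 * R / δ + C R * δ) < max |f x| |g x|) (hC : 0 ≤ C R) :
    ∃ z ∈ Icc x (x + δ), R < |f z| := by
  by_contra! hR
  refine hA.not_ge (max_le_max (hR x ⟨le_rfl, by linarith⟩) ?_)
  obtain ⟨w, hw, he⟩ := h.exists_slope hx (by linarith : x < x + δ) hxl
  have h1 := h.abs_sub_le R x w hx hw.1.le (by linarith [hw.2])
    fun z hz => hR z ⟨hz.1, hz.2.trans hw.2.le⟩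
  have h2 : C R * (w - x) ≤ C R * δ := by gcongr; linarith [hw.2]
  have h3 : |g w| ≤ 2 * R / δ := by
    rw [le_div_iff₀ hδ, show |g w| * δ = |f (x + δ) - f x| by
      rw [he, add_sub_cancel_left, abs_mul, abs_of_pos hδ]]
    refine (abs_sub _ _).trans ?_
    linarith [hR x ⟨le_rfl, by linarith⟩, hR (x + δ) ⟨by linarith, le_rfl⟩]
  have h4 : |g x| ≤ |g w| + |g w - g x| := by
    have := abs_sub_abs_le_abs_sub (g x) (g w)
    rw [abs_sub_comm (g x)] at this
    linarith
  linarith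

lemma exists_steep_zero (hC : ∀ R, 0 ≤ C R) {δ : ℝ} (hδ : 0 < δ) (T : ℝ) :
    ∃ A : ℝ, ∀ l f g, IsRestoringPair l C κ₀ f g → ∀ x, 0 ≤ x → x + 3 * δ ≤ l →
      A < max |f x| |g x| → ∃ z ∈ Ioc x (x + 3 * δ), f z = 0 ∧ T ≤ |g z| := by
  set κ := 16 / δ ^ 2
  have hκ : 0 < κ := by positivity
  have hκδ : 16 ≤ κ * δ ^ 2 := (div_mul_cancel₀ _ (by positivity)).ge
  set K := max 1 (κ₀ κ)
  have hK0 : 0 < K := one_pos.trans_le (le_max_left _ _)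
  set T' := max T (K / δ)
  have hT' : 0 < T' := lt_max_of_lt_right (by positivity)
  have hTK : K ≤ T' * δ := (div_le_iff₀ hδ).mp (le_max_right _ _)
  set R := K + δ * (T' + C K * δ)
  refine ⟨max R (2 * R / δ + C R * δ), fun l f g h x hx hxl hA => ?_⟩
  obtain ⟨z, hz, hfz⟩ := h.exists_abs_gt hδ hx (by linarith) hA (hC R)
  have hz0 : 0 ≤ z := hx.trans hz.1
  have hzl : z + 2 * δ ≤ l := by linarith [hz.2]
  obtain ⟨y, hy, hfy, hgy⟩ : ∃ y ∈ Ioc z (z + 2 * δ), f y = 0 ∧ T' ≤ |g y| := by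
    rcases lt_abs.mp hfz with h1 | h1
    · exact h.exists_zero_of_large hκ (le_max_right _ _) hK0 hδ hκδ (hC K) hT' hTK hz0 hzl h1
    · simpa using
        h.neg.exists_zero_of_large hκ (le_max_right _ _) hK0 hδ hκδ (hC K) hT' hTK hz0 hzl h1
  exact ⟨y, ⟨hz.1.trans_lt hy.1, by linarith [hy.2, hz.2]⟩, hfy, (le_max_left _ _).trans hgy⟩

lemma exists_zeros_right (hC : ∀ R, 0 ≤ C R) {δ : ℝ} (hδ : 0 < δ) (n : ℕ) :
    ∃ A : ℝ, 0 < A ∧ ∀ l f g, IsRestoringPair l C κ₀ f g → ∀ x, 0 ≤ x → x + n * (3 * δ) ≤ l →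
      A < max |f x| |g x| →
      ∃ s : Finset ℝ, s.card = n ∧ ∀ z ∈ s, z ∈ Ioc x l ∧ f z = 0 ∧ g z ≠ 0 := by
  induction n with
  | zero => exact ⟨1, one_pos, fun l f g _ x _ _ _ => ⟨∅, by simp⟩⟩
  | succ n ih =>
    obtain ⟨A, hA0, hA⟩ := ih
    obtain ⟨B, hB⟩ := exists_steep_zero (κ₀ := κ₀) hC hδ (A + 1)
    refine ⟨max A B, lt_max_of_lt_left hA0, fun l f g h x hx hxl hlt => ?_⟩
    push_cast at hxl
    have hn : 0 ≤ n * (3 * δ) := by positivity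
    obtain ⟨z, hz, hfz, hgz⟩ := hB l f g h x hx (by linarith) ((le_max_right _ _).trans_lt hlt)
    obtain ⟨s, hs, hsz⟩ := hA l f g h z (hx.trans hz.1.le) (by linarith [hz.2])
      (lt_max_of_lt_right (by linarith))
    refine ⟨insert z s, ?_, ?_⟩
    · rw [Finset.card_insert_of_notMem fun hmem => (hsz z hmem).1.1.ne rfl, hs]
    · intro y hy
      rcases Finset.mem_insert.mp hy with rfl | hy
      · exact ⟨⟨hz.1, by linarith [hz.2]⟩, hfz, abs_pos.mp (by linarith)⟩
      · exact ⟨⟨hz.1.trans (hsz y hy).1.1, (hsz y hy).1.2⟩, (hsz y hy).2⟩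

/-- If `f` is large somewhere, then it has many zeros. -/
theorem exists_zeros (hC : ∀ R, 0 ≤ C R) {l : ℝ} (hl : 0 < l) (n : ℕ) :
    ∃ A : ℝ, ∀ f g, IsRestoringPair l C κ₀ f g → ∀ x ∈ Icc 0 l, A < |f x| →
      ∃ s : Finset ℝ, s.card = n ∧ ∀ z ∈ s, z ∈ Icc 0 l ∧ f z = 0 ∧ g z ≠ 0 := by
  obtain ⟨A, -, hA⟩ := exists_zeros_right (κ₀ := κ₀) hC
    (by positivity : 0 < l / (6 * (n + 1))) n
  have hroom : n * (3 * (l / (6 * (n + 1)))) ≤ l / 2 := by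
    rw [show (n : ℝ) * (3 * (l / (6 * (n + 1)))) = l / 2 * (n / (n + 1)) by field_simp; ring]
    exact mul_le_of_le_one_right (by positivity)
      ((div_le_one (by positivity)).mpr (by linarith))
  refine ⟨A, fun f g h x hx hlt => ?_⟩
  rcases le_total x (l / 2) with hx2 | hx2
  · obtain ⟨s, hs, hsz⟩ := hA l f g h x hx.1 (by linarith) (lt_max_of_lt_left hlt)
    exact ⟨s, hs, fun z hz => ⟨⟨hx.1.trans (hsz z hz).1.1.le, (hsz z hz).1.2⟩, (hsz z hz).2⟩⟩
  · obtain ⟨s, hs, hsz⟩ := hA l _ _ h.reflect (l - x) (by linarith [hx.2]) (by linarith)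
      (lt_max_of_lt_left (by simpa using hlt))
    refine ⟨s.image (fun z => l - z), ?_, fun z hz => ?_⟩
    · rw [Finset.card_image_of_injective _ sub_right_injective, hs]
    · obtain ⟨y, hy, rfl⟩ := Finset.mem_image.mp hz
      obtain ⟨h1, h2, h3⟩ := hsz y hy
      exact ⟨⟨by linarith [h1.2], by linarith [h1.1, hx.2]⟩, h2, by simpa using h3⟩

end IsRestoringPair

namespace MetricGraph

variable {V E : Type*} {G : MetricGraph V E}

lemma continuous_fn (u : G.H1) (e : E) : Continuous (fn u e) :=
  EdgeFun.continuous_onEdge G u.1 e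

lemma fn_of_mem (u : G.H1) (e : E) {x : ℝ} (hx : x ∈ Icc 0 (G.len e)) :
    fn u e x = u.1 e ⟨x, hx⟩ := IccExtend_of_mem _ _ hx

lemma fn_add (u v : G.H1) (e : E) (x : ℝ) : fn (u + v) e x = fn u e x + fn v e x := by
  simp [fn, EdgeFun.onEdge, IccExtend]

lemma fn_smul (a : ℝ) (u : G.H1) (e : E) (x : ℝ) : fn (a • u) e x = a * fn u e x := by
  simp [fn, EdgeFun.onEdge, IccExtend]

lemma fn_zero (e : E) (x : ℝ) : fn (0 : G.H1) e x = 0 := by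
  simp [fn, EdgeFun.onEdge, IccExtend]

lemma H1_ext {u v : G.H1} (h : ∀ e, ∀ x ∈ Icc 0 (G.len e), fn u e x = fn v e x) : u = v := by
  refine Subtype.ext (funext fun e => ContinuousMap.ext fun x => ?_)
  have := h e x x.2
  rwa [fn_of_mem _ _ x.2, fn_of_mem _ _ x.2] at this

lemma memLp_weakDeriv (u : G.H1) (e : E) :
    MemLp (weakDeriv u e) 2 (volume.restrict (Ioo 0 (G.len e))) := (weakDeriv_spec u e).1

lemma integrableOn_weakDeriv (u : G.H1) (e : E) :
    IntegrableOn (weakDeriv u e) (Ioo 0 (G.len e)) :=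
  (memLp_weakDeriv u e).integrable (by norm_num)

lemma fn_eq_primitive (u : G.H1) (e : E) {x : ℝ} (hx : x ∈ Icc 0 (G.len e)) :
    fn u e x = fn u e 0 + ∫ t in (0 : ℝ)..x, weakDeriv u e t :=
  (weakDeriv_spec u e).2.eq_primitive (G.len_pos e) (continuous_fn u e).continuousOn
    (integrableOn_weakDeriv u e) hx

lemma fn_sub_fn (u : G.H1) (e : E) {x y : ℝ} (hx : x ∈ Icc 0 (G.len e))
    (hy : y ∈ Icc 0 (G.len e)) : fn u e y - fn u e x = ∫ t in x..y, weakDeriv u e t := by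
  have h0 : (0 : ℝ) ∈ Icc 0 (G.len e) := ⟨le_rfl, (G.len_pos e).le⟩
  rw [fn_eq_primitive u e hx, fn_eq_primitive u e hy, add_sub_add_left_eq_sub,
    intervalIntegral.integral_interval_sub_left
      (intervalIntegrable_of_integrableOn_Ioo (integrableOn_weakDeriv u e) h0 hy)
      (intervalIntegrable_of_integrableOn_Ioo (integrableOn_weakDeriv u e) h0 hx)]

lemma weakDeriv_ae_eq (u : G.H1) (e : E) {g : ℝ → ℝ}
    (hg : MemLp g 2 (volume.restrict (Ioo 0 (G.len e)))) (h : IsWeakDeriv (G.len e) (fn u e) g) :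
    weakDeriv u e =ᵐ[volume.restrict (Ioo 0 (G.len e))] g :=
  (weakDeriv_spec u e).2.ae_unique (memLp_weakDeriv u e) hg h

/-- A function that vanishes at both ends of an edge can be extended by zero to the other edges. -/
lemma exists_H1_single (e : E) {f g : ℝ → ℝ}
    (hg : MemLp g 2 (volume.restrict (Ioo 0 (G.len e))))
    (hf : ∀ x ∈ Icc 0 (G.len e), f x = ∫ t in (0 : ℝ)..x, g t) (hl : f (G.len e) = 0) :
    ∃ φ : G.H1, (∀ x ∈ Icc 0 (G.len e), fn φ e x = f x) ∧
      (weakDeriv φ e =ᵐ[volume.restrict (Ioo 0 (G.len e))] g) ∧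
      ∀ e' ≠ e, (∀ x, fn φ e' x = 0) ∧
        weakDeriv φ e' =ᵐ[volume.restrict (Ioo 0 (G.len e'))] 0 := by
  classical
  have hgi : IntegrableOn g (Ioo 0 (G.len e)) := hg.integrable (by norm_num)
  have hle := (G.len_pos e).le
  have hcont : ContinuousOn f (Icc 0 (G.len e)) := (continuousOn_primitive_Icc hle hgi).congr hf
  have h0 : f 0 = 0 := by simpa using hf 0 ⟨le_rfl, hle⟩
  set F : G.EdgeFun := Pi.single e ⟨(Icc 0 (G.len e)).domRestrict f, hcont.domRestrict⟩ with hF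
  have hFe : ∀ x ∈ Icc 0 (G.len e), F.onEdge e x = f x := fun x hx => by
    rw [EdgeFun.onEdge, IccExtend_of_mem _ _ hx, hF, Pi.single_eq_same]; rfl
  have hFe' : ∀ e' ≠ e, ∀ x, F.onEdge e' x = 0 := fun e' he x => by
    rw [EdgeFun.onEdge, hF, Pi.single_eq_of_ne he]; rfl
  have hwe : IsWeakDeriv (G.len e) (F.onEdge e) g :=
    isWeakDeriv_of_eq_primitive (c := 0) (G.len_pos e) hgi fun x hx => by
      rw [hFe x ⟨hx.1.le, hx.2.le⟩, hf x ⟨hx.1.le, hx.2.le⟩, zero_add]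
  have hwe' : ∀ e' ≠ e, IsWeakDeriv (G.len e') (F.onEdge e') 0 := fun e' he η _ _ _ => by
    simp [hFe' e' he]
  have hmem : F ∈ G.H1 := by
    refine ⟨⟨0, fun e' => ?_⟩, fun e' => ?_⟩
    · by_cases he : e' = e
      · subst he
        exact ⟨by rw [hFe 0 ⟨le_rfl, hle⟩, h0]; rfl, by rw [hFe _ ⟨hle, le_rfl⟩, hl]; rfl⟩
      · simp [hFe' e' he]
    · by_cases he : e' = e
      · subst he; exact ⟨g, hg, hwe⟩
      · exact ⟨0, MemLp.zero, hwe' e' he⟩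
  refine ⟨⟨F, hmem⟩, hFe, weakDeriv_ae_eq _ e hg hwe, fun e' he => ⟨hFe' e' he, ?_⟩⟩
  exact weakDeriv_ae_eq _ e' MemLp.zero (hwe' e' he)

variable {p : ℝ} {W ρ : E → ℝ → ℝ} {lam : ℝ} {u : G.H1}

/-- Testing the equation with a function that lives on a single edge. -/
lemma IsSolution.edge [Fintype E] (h : IsSolution p W ρ lam u) (e : E) {φ : G.H1}
    (hφ : ∀ e' ≠ e, (∀ x, fn φ e' x = 0) ∧
        weakDeriv φ e' =ᵐ[volume.restrict (Ioo 0 (G.len e'))] 0) :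
    ∫ x in Ioo 0 (G.len e),
        (weakDeriv u e x * weakDeriv φ e x + (W e x + lam) * fn u e x * fn φ e x) =
      ∫ x in Ioo 0 (G.len e), ρ e x * |fn u e x| ^ (p - 2) * fn u e x * fn φ e x := by
  have := h φ
  rwa [Finset.sum_eq_single_of_mem e (Finset.mem_univ e), Finset.sum_eq_single_of_mem e
    (Finset.mem_univ e)] at this
  · intro e' _ he
    simp [(hφ e' he).1]
  · intro e' _ he
    refine integral_eq_zero_of_ae ?_
    filter_upwards [(hφ e' he).2] with x hx
    simp [(hφ e' he).1, hx]

/-- The second derivative of a solution. -/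
def source (p : ℝ) (W ρ : E → ℝ → ℝ) (lam : ℝ) (u : G.H1) (e : E) (x : ℝ) : ℝ :=
  (W e x + lam) * fn u e x - ρ e x * |fn u e x| ^ (p - 2) * fn u e x

lemma continuous_abs_fn_rpow (hp : 2 < p) (u : G.H1) (e : E) :
    Continuous fun x => |fn u e x| ^ (p - 2) :=
  (continuous_fn u e).abs.rpow_const fun _ => .inr (by linarith)

lemma exists_abs_fn_le (u : G.H1) (e : E) : ∃ M, 0 ≤ M ∧ ∀ x ∈ Icc 0 (G.len e), |fn u e x| ≤ M := by
  obtain ⟨M, hM⟩ := isCompact_Icc.exists_bound_of_continuousOn (continuous_fn u e).continuousOn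
    (s := Icc 0 (G.len e))
  exact ⟨M, (norm_nonneg _).trans (hM 0 ⟨le_rfl, (G.len_pos e).le⟩), hM⟩

lemma integrableOn_linear (hW : ∀ e, MemLp (W e) ∞ (volume.restrict (Ioo 0 (G.len e))))
    (lam : ℝ) (e : E) {f : ℝ → ℝ} (hf : ContinuousOn f (Icc 0 (G.len e))) :
    IntegrableOn (fun x => (W e x + lam) * f x) (Ioo 0 (G.len e)) := by
  have h1 : IntegrableOn f (Ioo 0 (G.len e)) :=
    (hf.integrableOn_compact isCompact_Icc).mono_set Ioo_subset_Icc_self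
  exact h1.mul_of_top_right ((hW e).add (memLp_const lam))

lemma integrableOn_nonlinear (hp : 2 < p)
    (hρ : ∀ e, MemLp (ρ e) ∞ (volume.restrict (Ioo 0 (G.len e)))) (u : G.H1) (e : E)
    {f : ℝ → ℝ} (hf : ContinuousOn f (Icc 0 (G.len e))) :
    IntegrableOn (fun x => ρ e x * |fn u e x| ^ (p - 2) * f x) (Ioo 0 (G.len e)) := by
  have h1 : IntegrableOn (fun x => |fn u e x| ^ (p - 2) * f x) (Ioo 0 (G.len e)) :=
    (((continuous_abs_fn_rpow hp u e).continuousOn.mul hf).integrableOn_compact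
      isCompact_Icc).mono_set Ioo_subset_Icc_self
  simp_rw [mul_assoc]
  exact h1.mul_of_top_right (hρ e)

lemma integrableOn_source (hp : 2 < p)
    (hW : ∀ e, MemLp (W e) ∞ (volume.restrict (Ioo 0 (G.len e))))
    (hρ : ∀ e, MemLp (ρ e) ∞ (volume.restrict (Ioo 0 (G.len e)))) (lam : ℝ) (u : G.H1) (e : E) :
    IntegrableOn (source p W ρ lam u e) (Ioo 0 (G.len e)) :=
  (integrableOn_linear hW lam e (continuous_fn u e).continuousOn).sub
    (integrableOn_nonlinear hp hρ u e (continuous_fn u e).continuousOn)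

lemma IsSolution.isWeakDeriv_weakDeriv [Fintype E] (hp : 2 < p)
    (hW : ∀ e, MemLp (W e) ∞ (volume.restrict (Ioo 0 (G.len e))))
    (hρ : ∀ e, MemLp (ρ e) ∞ (volume.restrict (Ioo 0 (G.len e))))
    (h : IsSolution p W ρ lam u) (e : E) :
    IsWeakDeriv (G.len e) (weakDeriv u e) (source p W ρ lam u e) := by
  intro η hη hc hs
  have hη' : Continuous (deriv η) := hη.continuous_deriv (by simp)
  have h0 : η 0 = 0 := image_eq_zero_of_notMem_tsupport fun h => (hs h).1.ne rfl
  have h1 : η (G.len e) = 0 := image_eq_zero_of_notMem_tsupport fun h => (hs h).2.ne rfl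
  obtain ⟨φ, hφ, hφ', hφe⟩ := exists_H1_single (G := G) e (f := η) (g := deriv η)
    ((hη'.memLp_of_hasCompactSupport hc.deriv).restrict _)
    (fun x _ => by
      rw [intervalIntegral.integral_deriv_eq_sub (fun y _ => hη.differentiable (by simp) y)
        (hη'.intervalIntegrable _ _), h0, sub_zero]) h1
  have key := h.edge e hφe
  have huη : IntegrableOn (fun x => weakDeriv u e x * deriv η x) (Ioo 0 (G.len e)) := by
    obtain ⟨C, hC⟩ := hc.deriv.exists_bound_of_continuous hη'
    exact (integrableOn_weakDeriv u e).mul_bdd hη'.aestronglyMeasurable (.of_forall hC)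
  have hηu : ContinuousOn (fun x => fn u e x * η x) (Icc 0 (G.len e)) :=
    ((continuous_fn u e).mul hη.continuous).continuousOn
  have hL := integrableOn_linear hW lam e hηu
  have hN := integrableOn_nonlinear hp hρ u e hηu
  have e1 : ∫ x in Ioo 0 (G.len e),
      (weakDeriv u e x * weakDeriv φ e x + (W e x + lam) * fn u e x * fn φ e x) =
      (∫ x in Ioo 0 (G.len e), weakDeriv u e x * deriv η x) +
        ∫ x in Ioo 0 (G.len e), (W e x + lam) * (fn u e x * η x) := by
    rw [← integral_add huη hL]
    refine integral_congr_ae ?_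
    filter_upwards [hφ', ae_restrict_mem measurableSet_Ioo] with x hx hmem
    rw [hx, hφ x ⟨hmem.1.le, hmem.2.le⟩]; ring
  have e2 : ∫ x in Ioo 0 (G.len e), ρ e x * |fn u e x| ^ (p - 2) * fn u e x * fn φ e x =
      ∫ x in Ioo 0 (G.len e), ρ e x * |fn u e x| ^ (p - 2) * (fn u e x * η x) := by
    refine setIntegral_congr_fun measurableSet_Ioo fun x hmem => ?_
    simp only [hφ x ⟨hmem.1.le, hmem.2.le⟩]; ring
  have e3 : ∫ x in Ioo 0 (G.len e), source p W ρ lam u e x * η x =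
      (∫ x in Ioo 0 (G.len e), (W e x + lam) * (fn u e x * η x)) -
        ∫ x in Ioo 0 (G.len e), ρ e x * |fn u e x| ^ (p - 2) * (fn u e x * η x) := by
    rw [← integral_sub hL hN]
    congr 1; ext x; rw [source]; ring
  rw [e1, e2] at key
  rw [e3]; linarith

/-- A solution is of class `C¹` on closed edges, and its derivative is a primitive of `source`. -/
lemma IsSolution.exists_deriv [Fintype E] (hp : 2 < p)
    (hW : ∀ e, MemLp (W e) ∞ (volume.restrict (Ioo 0 (G.len e))))
    (hρ : ∀ e, MemLp (ρ e) ∞ (volume.restrict (Ioo 0 (G.len e))))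
    (h : IsSolution p W ρ lam u) (e : E) :
    ∃ g : ℝ → ℝ, Continuous g ∧
      (∀ x ∈ Icc 0 (G.len e), fn u e x = fn u e 0 + ∫ t in (0 : ℝ)..x, g t) ∧
      (∀ x ∈ Icc 0 (G.len e), ∀ y ∈ Icc 0 (G.len e),
        g y - g x = ∫ t in x..y, source p W ρ lam u e t) := by
  have hs := integrableOn_source hp hW hρ lam u e
  have hle := (G.len_pos e).le
  obtain ⟨c, hc⟩ := (h.isWeakDeriv_weakDeriv hp hW hρ e).exists_ae_eq_primitive (G.len_pos e)
    (integrableOn_weakDeriv u e) hs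
  have hcont := (continuousOn_const (c := c)).add (continuousOn_primitive_Icc hle hs)
  set g := IccExtend hle ((Icc 0 (G.len e)).domRestrict
    fun x => c + ∫ t in (0 : ℝ)..x, source p W ρ lam u e t) with hg
  have hgx : ∀ x ∈ Icc 0 (G.len e), g x = c + ∫ t in (0 : ℝ)..x, source p W ρ lam u e t :=
    fun x hx => by rw [hg, IccExtend_of_mem _ _ hx]; rfl
  refine ⟨g, hcont.domRestrict.Icc_extend', fun x hx => ?_, fun x hx y hy => ?_⟩
  · rw [fn_eq_primitive u e hx]
    congr 1
    refine intervalIntegral.integral_congr_ae ?_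
    rw [ae_restrict_iff' measurableSet_Ioo] at hc
    have hne : ∀ᵐ t : ℝ, t ≠ G.len e := by simp [ae_iff]
    filter_upwards [hc, hne] with t ht htl hmem
    rw [uIoc_of_le hx.1] at hmem
    rw [ht ⟨hmem.1, (hmem.2.trans hx.2).lt_of_ne htl⟩,
      hgx t ⟨hmem.1.le, hmem.2.trans hx.2⟩]
  · have h0 : (0 : ℝ) ∈ Icc 0 (G.len e) := ⟨le_rfl, hle⟩
    rw [hgx x hx, hgx y hy, add_sub_add_left_eq_sub, intervalIntegral.integral_interval_sub_left
      (intervalIntegrable_of_integrableOn_Ioo hs h0 hy)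
      (intervalIntegrable_of_integrableOn_Ioo hs h0 hx)]

lemma hasDerivWithinAt_fn {e : E} {g : ℝ → ℝ} (hg : Continuous g)
    (hu : ∀ x ∈ Icc 0 (G.len e), fn u e x = fn u e 0 + ∫ t in (0 : ℝ)..x, g t) {x : ℝ}
    (hx : x ∈ Icc 0 (G.len e)) : HasDerivWithinAt (fn u e) (g x) (Icc 0 (G.len e)) x := by
  have : HasDerivAt (fun x => fn u e 0 + ∫ t in (0 : ℝ)..x, g t) (g x) x :=
    (intervalIntegral.integral_hasDerivAt_right (hg.intervalIntegrable _ _)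
      (hg.stronglyMeasurableAtFilter _ _) hg.continuousAt).const_add _
  exact this.hasDerivWithinAt.congr hu (hu x hx)

lemma IsSolution.contDiffOn [Fintype E] (hp : 2 < p)
    (hW : ∀ e, MemLp (W e) ∞ (volume.restrict (Ioo 0 (G.len e))))
    (hρ : ∀ e, MemLp (ρ e) ∞ (volume.restrict (Ioo 0 (G.len e))))
    (h : IsSolution p W ρ lam u) (e : E) : ContDiffOn ℝ 1 (fn u e) (Icc 0 (G.len e)) := by
  obtain ⟨g, hg, hu, -⟩ := h.exists_deriv hp hW hρ e
  have hd : ∀ x, HasDerivAt (fun x => fn u e 0 + ∫ t in (0 : ℝ)..x, g t) (g x) x := fun x =>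
    (intervalIntegral.integral_hasDerivAt_right (hg.intervalIntegrable _ _)
      (hg.stronglyMeasurableAtFilter _ _) hg.continuousAt).const_add _
  have : ContDiff ℝ 1 (fun x => fn u e 0 + ∫ t in (0 : ℝ)..x, g t) := by
    rw [contDiff_one_iff_deriv, funext fun x => (hd x).deriv]
    exact ⟨fun x => (hd x).differentiableAt, hg⟩
  exact this.contDiffOn.congr hu

end MetricGraph

lemma IsRestoringPair.abs_deriv_le {l : ℝ} {C κ₀ f g : ℝ → ℝ} (h : IsRestoringPair l C κ₀ f g)
    (hl : 0 < l) {M : ℝ} (hC : 0 ≤ C M) (hM : ∀ x ∈ Icc 0 l, |f x| ≤ M) {x : ℝ}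
    (hx : x ∈ Icc 0 l) : |g x| ≤ 2 * M / l + C M * l := by
  obtain ⟨w, hw, he⟩ := h.exists_slope le_rfl hl le_rfl
  have h1 : |g w| ≤ 2 * M / l := by
    rw [le_div_iff₀ hl, show |g w| * l = |f l - f 0| by
      rw [he, sub_zero, abs_mul, abs_of_pos hl]]
    refine (abs_sub _ _).trans ?_
    linarith [hM l ⟨hl.le, le_rfl⟩, hM 0 ⟨le_rfl, hl.le⟩]
  have h2 : |g x - g w| ≤ C M * l := by
    rcases le_total w x with hwx | hwx
    · refine (h.abs_sub_le M w x hw.1.le hwx hx.2 fun z hz =>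
        hM z ⟨hw.1.le.trans hz.1, hz.2.trans hx.2⟩).trans ?_
      gcongr; linarith [hw.1, hx.2]
    · rw [abs_sub_comm]
      refine (h.abs_sub_le M x w hx.1 hwx hw.2.le fun z hz =>
        hM z ⟨hx.1.trans hz.1, hz.2.trans hw.2.le⟩).trans ?_
      gcongr; linarith [hw.2, hx.1]
  linarith [abs_sub_abs_le_abs_sub (g x) (g w)]

namespace MetricGraph

variable {V E : Type*} {G : MetricGraph V E}

/-- Almost everywhere bounds for the coefficients of the equation. -/
def CoeffBounds (G : MetricGraph V E) (W ρ : E → ℝ → ℝ) (a B : ℝ) : Prop :=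
  ∀ e, ∀ᵐ x ∂(volume.restrict (Ioo 0 (G.len e))), |W e x| ≤ B ∧ a ≤ ρ e x ∧ ρ e x ≤ B

lemma exists_ae_abs_le [Finite E] {w : E → ℝ → ℝ}
    (hw : ∀ e, MemLp (w e) ∞ (volume.restrict (Ioo 0 (G.len e)))) :
    ∃ B : ℝ, ∀ e, ∀ᵐ x ∂(volume.restrict (Ioo 0 (G.len e))), |w e x| ≤ B := by
  have : ∀ e, ∃ B : ℝ, ∀ᵐ x ∂(volume.restrict (Ioo 0 (G.len e))), |w e x| ≤ B := fun e => by
    refine ⟨(eLpNorm (w e) ∞ (volume.restrict (Ioo 0 (G.len e)))).toReal, ?_⟩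
    have := ae_le_eLpNormEssSup (f := w e) (μ := volume.restrict (Ioo 0 (G.len e)))
    filter_upwards [this] with x hx
    rw [← Real.norm_eq_abs, ← toReal_enorm]
    exact ENNReal.toReal_mono (hw e).2.ne (by rwa [eLpNorm_exponent_top])
  choose B hB using this
  obtain ⟨M, hM⟩ := Finite.exists_le B
  exact ⟨M, fun e => (hB e).mono fun x hx => hx.trans (hM e)⟩

lemma exists_coeffBounds [Finite E] {W ρ : E → ℝ → ℝ}
    (hW : ∀ e, MemLp (W e) ∞ (volume.restrict (Ioo 0 (G.len e))))
    (hρ : ∀ e, MemLp (ρ e) ∞ (volume.restrict (Ioo 0 (G.len e))))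
    (hinf : ∃ a > 0, ∀ e, ∀ᵐ x ∂(volume.restrict (Ioo 0 (G.len e))), a ≤ ρ e x) :
    ∃ a > 0, ∃ B, 0 ≤ B ∧ CoeffBounds G W ρ a B := by
  obtain ⟨a, ha, hρa⟩ := hinf
  obtain ⟨B₁, h₁⟩ := exists_ae_abs_le hW
  obtain ⟨B₂, h₂⟩ := exists_ae_abs_le hρ
  refine ⟨a, ha, max 0 (max B₁ B₂), le_max_left _ _, fun e => ?_⟩
  filter_upwards [h₁ e, h₂ e, hρa e] with x hx₁ hx₂ hx
  exact ⟨hx₁.trans ((le_max_left _ _).trans (le_max_right _ _)), hx,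
    (le_abs_self _).trans (hx₂.trans ((le_max_right _ _).trans (le_max_right _ _)))⟩

/-- A bound for `source` where `|u| ≤ R`. -/
def sourceBound (p B Λ R : ℝ) : ℝ := (B + Λ) * |R| + B * |R| ^ (p - 2) * |R|

lemma sourceBound_nonneg {B Λ : ℝ} (hB : 0 ≤ B) (hΛ : 0 ≤ Λ) (p R : ℝ) :
    0 ≤ sourceBound p B Λ R := by
  rw [sourceBound]; positivity

/-- The linear coefficient `ρ |u| ^ (p - 2) - W - lam` is at least `κ` where
`|u| ≥ restoringLevel p a B Λ κ`. -/
def restoringLevel (p a B Λ κ : ℝ) : ℝ := ((κ + B + Λ) / a) ^ (1 / (p - 2))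

variable {p : ℝ} {W ρ : E → ℝ → ℝ} {lam : ℝ} {u : G.H1} {a B Λ : ℝ}

lemma abs_source_le (hp : 2 < p) (ha : 0 < a) (hB : 0 ≤ B) (hlam : |lam| ≤ Λ) {e : E} {x R : ℝ}
    (hx : |W e x| ≤ B ∧ a ≤ ρ e x ∧ ρ e x ≤ B) (hR : |fn u e x| ≤ R) :
    |source p W ρ lam u e x| ≤ sourceBound p B Λ R := by
  have hR0 : 0 ≤ R := (abs_nonneg _).trans hR
  have h1 : |fn u e x| ^ (p - 2) ≤ R ^ (p - 2) :=
    Real.rpow_le_rpow (abs_nonneg _) hR (by linarith)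
  have h2 : |W e x + lam| ≤ B + Λ := (abs_add_le _ _).trans (add_le_add hx.1 hlam)
  rw [source, sourceBound, abs_of_nonneg hR0]
  refine (abs_sub _ _).trans (add_le_add ?_ ?_)
  · rw [abs_mul]
    exact mul_le_mul h2 hR (abs_nonneg _) ((abs_nonneg _).trans h2)
  · rw [abs_mul, abs_mul, abs_of_pos (ha.trans_le hx.2.1),
      abs_of_nonneg (Real.rpow_nonneg (abs_nonneg _) _)]
    exact mul_le_mul (mul_le_mul hx.2.2 h1 (by positivity) hB) hR (abs_nonneg _) (by positivity)

lemma le_restoring_coeff (hp : 2 < p) (ha : 0 < a) (hB : 0 ≤ B) (hlam : |lam| ≤ Λ) {e : E}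
    {x κ : ℝ} (hκ : 0 < κ) (hx : |W e x| ≤ B ∧ a ≤ ρ e x ∧ ρ e x ≤ B)
    (hK : restoringLevel p a B Λ κ ≤ |fn u e x|) :
    κ ≤ ρ e x * |fn u e x| ^ (p - 2) - (W e x + lam) := by
  have hΛ : 0 ≤ Λ := (abs_nonneg _).trans hlam
  have hq : 0 ≤ (κ + B + Λ) / a := by positivity
  have h1 : (κ + B + Λ) / a ≤ |fn u e x| ^ (p - 2) := by
    have := Real.rpow_le_rpow (Real.rpow_nonneg hq _) hK (by linarith : 0 ≤ p - 2)
    rwa [← Real.rpow_mul hq, one_div_mul_cancel (by linarith), Real.rpow_one] at this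
  have h2 : κ + B + Λ ≤ ρ e x * |fn u e x| ^ (p - 2) := by
    rw [div_le_iff₀ ha, mul_comm] at h1
    exact h1.trans (mul_le_mul_of_nonneg_right hx.2.1 (by positivity))
  linarith [le_abs_self (W e x), le_abs_self lam, hx.1]

lemma restoringLevel_nonneg {p a B Λ κ : ℝ} (ha : 0 < a) (hB : 0 ≤ B) (hΛ : 0 ≤ Λ)
    (hκ : 0 < κ) : 0 ≤ restoringLevel p a B Λ κ := by
  rw [restoringLevel]; positivity

lemma IsSolution.exists_isRestoringPair [Fintype E] (hp : 2 < p)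
    (hW : ∀ e, MemLp (W e) ∞ (volume.restrict (Ioo 0 (G.len e))))
    (hρ : ∀ e, MemLp (ρ e) ∞ (volume.restrict (Ioo 0 (G.len e))))
    (ha : 0 < a) (hB : 0 ≤ B) (hcoeff : CoeffBounds G W ρ a B) (hlam : |lam| ≤ Λ)
    (h : IsSolution p W ρ lam u) (e : E) :
    ∃ g, IsRestoringPair (G.len e) (sourceBound p B Λ) (restoringLevel p a B Λ) (fn u e) g := by
  have hΛ : 0 ≤ Λ := (abs_nonneg _).trans hlam
  obtain ⟨g, hg, hu, hgs⟩ := h.exists_deriv hp hW hρ e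
  have hae : ∀ᵐ x, x ∈ Icc 0 (G.len e) → |W e x| ≤ B ∧ a ≤ ρ e x ∧ ρ e x ≤ B := by
    rw [← ae_restrict_iff' measurableSet_Icc, ← restrict_Ioo_eq_restrict_Icc]
    exact hcoeff e
  have hint := fun x y (hx : x ∈ Icc 0 (G.len e)) (hy : y ∈ Icc 0 (G.len e)) =>
    intervalIntegrable_of_integrableOn_Ioo (integrableOn_source hp hW hρ lam u e) hx hy
  have hconst : ∀ x y c : ℝ, ∫ _ in x..y, c = c * (y - x) := fun x y c => by
    rw [intervalIntegral.integral_const, smul_eq_mul, mul_comm]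
  refine ⟨g, fun x hx => hasDerivWithinAt_fn hg hu hx, hg.continuousOn, ?_, ?_, ?_⟩
  · intro R x y hx hxy hy hR
    rw [hgs x ⟨hx, hxy.trans hy⟩ y ⟨hx.trans hxy, hy⟩, ← abs_of_nonneg (sub_nonneg.mpr hxy)]
    refine intervalIntegral.norm_integral_le_of_norm_le_const_ae (E := ℝ) ?_
    filter_upwards [hae] with z hz hmem
    rw [uIoc_of_le hxy] at hmem
    exact abs_source_le hp ha hB hlam (hz ⟨hx.trans hmem.1.le, hmem.2.trans hy⟩)
      (hR z ⟨hmem.1.le, hmem.2⟩)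
  · intro κ hκ K hK x y hx hxy hy hf
    rw [hgs x ⟨hx, hxy.trans hy⟩ y ⟨hx.trans hxy, hy⟩, ← neg_mul, ← hconst]
    refine intervalIntegral.integral_mono_ae_restrict hxy
      (hint x y ⟨hx, hxy.trans hy⟩ ⟨hx.trans hxy, hy⟩) intervalIntegrable_const ?_
    rw [Filter.EventuallyLE, ae_restrict_iff' measurableSet_Icc]
    filter_upwards [hae] with z hz hmem
    have hK0 : 0 ≤ K := (restoringLevel_nonneg ha hB hΛ hκ).trans hK
    have h1 := hf z hmem
    have h2 := le_restoring_coeff hp ha hB hlam hκ (hz ⟨hx.trans hmem.1, hmem.2.trans hy⟩)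
      (hK.le.trans (h1.trans (le_abs_self _)))
    have h3 := mul_le_mul h2 h1 hK0 (hκ.le.trans h2)
    rw [source]; linarith
  · intro κ hκ K hK x y hx hxy hy hf
    rw [hgs x ⟨hx, hxy.trans hy⟩ y ⟨hx.trans hxy, hy⟩, ← hconst]
    refine intervalIntegral.integral_mono_ae_restrict hxy intervalIntegrable_const
      (hint x y ⟨hx, hxy.trans hy⟩ ⟨hx.trans hxy, hy⟩) ?_
    rw [Filter.EventuallyLE, ae_restrict_iff' measurableSet_Icc]
    filter_upwards [hae] with z hz hmem
    have hK0 : 0 ≤ K := (restoringLevel_nonneg ha hB hΛ hκ).trans hK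
    have h1 := hf z hmem
    have h2 := le_restoring_coeff hp ha hB hlam hκ (hz ⟨hx.trans hmem.1, hmem.2.trans hy⟩)
      (hK.le.trans (h1.trans (neg_le_abs _)))
    have h3 := mul_le_mul h2 h1 hK0 (hκ.le.trans h2)
    rw [source]; linarith

lemma abs_fn_le_of_normLinfty_le (u : G.H1) {c : ℝ≥0∞} (hc : c ≠ ⊤) (h : normLinfty u ≤ c) (e : E)
    {x : ℝ} (hx : x ∈ Icc 0 (G.len e)) : |fn u e x| ≤ c.toReal := by
  have hae : ∀ᵐ x ∂(volume.restrict (Icc 0 (G.len e))), min |fn u e x| c.toReal = |fn u e x| := by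
    rw [← restrict_Ioo_eq_restrict_Icc]
    filter_upwards [ae_le_eLpNormEssSup (f := fn u e) (μ := volume.restrict (Ioo 0 (G.len e)))]
      with x hx
    refine min_eq_left ?_
    rw [← Real.norm_eq_abs, ← toReal_enorm]
    refine ENNReal.toReal_mono hc (hx.trans (le_trans ?_ h))
    rw [← eLpNorm_exponent_top]
    exact le_iSup (fun e => eLpNorm (fn u e) ∞ (volume.restrict (Ioo 0 (G.len e)))) e
  have := Measure.eqOn_Icc_of_ae_eq volume (G.len_pos e).ne hae
    ((continuous_fn u e).abs.min continuous_const).continuousOn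
    (continuous_fn u e).abs.continuousOn hx
  exact min_eq_left_iff.mp this

lemma normLinfty_le_normC1 (u : G.H1) : normLinfty u ≤ ⨆ e, normC1 u e := by
  refine iSup_mono fun e => ?_
  rw [eLpNorm_exponent_top]
  refine (eLpNormEssSup_le_of_ae_enorm_bound ?_).trans le_self_add
  filter_upwards [ae_restrict_mem measurableSet_Ioo] with x hx
  exact le_iSup₂_of_le x ⟨hx.1.le, hx.2.le⟩ le_rfl

lemma IsSolution.normC1_le [Fintype E] (hp : 2 < p)
    (hW : ∀ e, MemLp (W e) ∞ (volume.restrict (Ioo 0 (G.len e))))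
    (hρ : ∀ e, MemLp (ρ e) ∞ (volume.restrict (Ioo 0 (G.len e))))
    (ha : 0 < a) (hB : 0 ≤ B) (hcoeff : CoeffBounds G W ρ a B) (hlam : |lam| ≤ Λ)
    (h : IsSolution p W ρ lam u) {M : ℝ} {e : E} (hM : ∀ x ∈ Icc 0 (G.len e), |fn u e x| ≤ M) :
    normC1 u e ≤ ENNReal.ofReal M +
      ENNReal.ofReal (2 * M / G.len e + sourceBound p B Λ M * G.len e) := by
  obtain ⟨g, hg⟩ := h.exists_isRestoringPair hp hW hρ ha hB hcoeff hlam e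
  refine add_le_add (iSup₂_le fun x hx => ?_) (iSup₂_le fun x hx => ?_)
  · rw [Real.enorm_eq_ofReal_abs]
    exact ENNReal.ofReal_le_ofReal (hM x hx)
  · rw [(hg.hasDeriv x hx).derivWithin (uniqueDiffOn_Icc (G.len_pos e) x hx),
      Real.enorm_eq_ofReal_abs]
    exact ENNReal.ofReal_le_ofReal (hg.abs_deriv_le (G.len_pos e)
      (sourceBound_nonneg hB ((abs_nonneg _).trans hlam) p M) hM hx)

end MetricGraph

lemma sq_intervalIntegral_le {g : ℝ → ℝ} {x y d : ℝ} (hxy : x ≤ y) (hd : 0 < d) (hyd : y - x ≤ d)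
    (hg : IntervalIntegrable g volume x y)
    (hg2 : IntervalIntegrable (fun t => g t ^ 2) volume x y) :
    (∫ t in x..y, g t) ^ 2 ≤ d * ∫ t in x..y, g t ^ 2 := by
  set I := ∫ t in x..y, g t with hI
  have h1 : ∫ t in x..y, (2 * (I / d) * g t - (I / d) ^ 2) ≤ ∫ t in x..y, g t ^ 2 :=
    intervalIntegral.integral_mono_on hxy ((hg.const_mul _).sub intervalIntegrable_const) hg2
      fun t _ => by nlinarith [sq_nonneg (g t - I / d)]
  rw [intervalIntegral.integral_sub (hg.const_mul _) intervalIntegrable_const,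
    intervalIntegral.integral_const_mul, intervalIntegral.integral_const, ← hI, smul_eq_mul] at h1
  have h2 : (y - x) * (I / d) ^ 2 ≤ d * (I / d) ^ 2 := by gcongr
  have h3 : I ^ 2 = d * (2 * (I / d) * I - d * (I / d) ^ 2) := by field_simp; ring
  rw [h3]
  gcongr
  linarith

lemma exists_mem_ne_zero_of_card_lt_finrank {M ι : Type*} [AddCommGroup M] [Module ℝ M]
    [Fintype ι] (X : Submodule ℝ M) (T : M →ₗ[ℝ] (ι → ℝ))
    (h : Fintype.card ι < Module.finrank ℝ X) : ∃ φ ∈ X, φ ≠ 0 ∧ T φ = 0 := by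
  have : Module.Finite ℝ X := Module.finite_of_finrank_pos ((Nat.zero_le _).trans_lt h)
  have hker : LinearMap.ker (T.domRestrict X) ≠ ⊥ := LinearMap.ker_ne_bot_of_finrank_lt
    (by rwa [Module.finrank_fintype_fun_eq_card])
  obtain ⟨φ, hφ, hφ0⟩ := (Submodule.ne_bot_iff _).mp hker
  exact ⟨φ, φ.2, fun h0 => hφ0 (Subtype.ext h0), hφ⟩

namespace MetricGraph

variable {V E : Type*} {G : MetricGraph V E}

lemma integrableOn_weakDeriv_sq (φ : G.H1) (e : E) :
    IntegrableOn (fun x => weakDeriv φ e x ^ 2) (Ioo 0 (G.len e)) :=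
  (memLp_weakDeriv φ e).integrable_sq

/-- A Poincaré inequality for functions that vanish at the left end of an interval. -/
lemma integral_sq_le_of_eq_zero (φ : G.H1) (e : E) {x y : ℝ} (hx : 0 ≤ x) (hxy : x ≤ y)
    (hy : y ≤ G.len e) (h0 : fn φ e x = 0) :
    ∫ t in x..y, fn φ e t ^ 2 ≤ (y - x) ^ 2 * ∫ t in x..y, weakDeriv φ e t ^ 2 := by
  rcases hxy.eq_or_lt with rfl | hlt
  · simp
  have hxm : x ∈ Icc 0 (G.len e) := ⟨hx, hxy.trans hy⟩
  have hsq := fun s t (hs : s ∈ Icc 0 (G.len e)) (ht : t ∈ Icc 0 (G.len e)) =>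
    intervalIntegrable_of_integrableOn_Ioo (integrableOn_weakDeriv_sq φ e) hs ht
  have hpt : ∀ t ∈ Icc x y, fn φ e t ^ 2 ≤ (y - x) * ∫ t in x..y, weakDeriv φ e t ^ 2 := by
    intro t ht
    have htm : t ∈ Icc 0 (G.len e) := ⟨hx.trans ht.1, ht.2.trans hy⟩
    have h1 := fn_sub_fn φ e hxm htm
    rw [h0, sub_zero] at h1
    rw [h1]
    refine (sq_intervalIntegral_le ht.1 (sub_pos.mpr hlt) (by linarith [ht.2])
      (intervalIntegrable_of_integrableOn_Ioo (integrableOn_weakDeriv φ e) hxm htm)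
      (hsq x t hxm htm)).trans ?_
    refine mul_le_mul_of_nonneg_left ?_ (by linarith)
    refine intervalIntegral.integral_mono_interval le_rfl ht.1 ht.2
      (.of_forall fun _ => sq_nonneg _) (hsq x y hxm ⟨hx.trans hxy, hy⟩)
  refine (intervalIntegral.integral_mono_on hxy
    (((continuous_fn φ e).pow 2).intervalIntegrable _ _) intervalIntegrable_const hpt).trans ?_
  rw [intervalIntegral.integral_const, smul_eq_mul]
  exact le_of_eq (by ring)

lemma integral_sq_le_of_grid (φ : G.H1) (e : E) {n : ℕ} (hn : 0 < n)
    (h0 : ∀ k < n, fn φ e (k * (G.len e / n)) = 0) :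
    ∫ x in Ioo 0 (G.len e), fn φ e x ^ 2 ≤
      (G.len e / n) ^ 2 * ∫ x in Ioo 0 (G.len e), weakDeriv φ e x ^ 2 := by
  have hl := G.len_pos e
  have hn' : (0 : ℝ) < n := by exact_mod_cast hn
  have hend : ((n : ℕ) : ℝ) * (G.len e / n) = G.len e := by field_simp
  have hmem : ∀ k : ℕ, k ≤ n → (k : ℝ) * (G.len e / n) ∈ Icc 0 (G.len e) := fun k hk => by
    refine ⟨by positivity, ?_⟩
    conv_rhs => rw [← hend]
    gcongr
  rw [integral_Ioo_eq_intervalIntegral hl.le, integral_Ioo_eq_intervalIntegral hl.le]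
  have e1 := intervalIntegral.sum_integral_adjacent_intervals (f := fun x => fn φ e x ^ 2)
    (μ := volume) (a := fun k : ℕ => (k : ℝ) * (G.len e / n)) (n := n)
    fun k _ => ((continuous_fn φ e).pow 2).intervalIntegrable _ _
  have e2 := intervalIntegral.sum_integral_adjacent_intervals
    (f := fun x => weakDeriv φ e x ^ 2)
    (μ := volume) (a := fun k : ℕ => (k : ℝ) * (G.len e / n)) (n := n)
    fun k hk => intervalIntegrable_of_integrableOn_Ioo (integrableOn_weakDeriv_sq φ e)
      (hmem k hk.le) (hmem (k + 1) hk)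
  simp only [hend, Nat.cast_zero, zero_mul] at e1 e2
  rw [← e1, ← e2, Finset.mul_sum]
  refine Finset.sum_le_sum fun k hk => ?_
  have hk := Finset.mem_range.mp hk
  have hd : ((k + 1 : ℕ) : ℝ) * (G.len e / n) - k * (G.len e / n) = G.len e / n := by
    push_cast; ring
  have := integral_sq_le_of_eq_zero φ e (x := k * (G.len e / n))
    (y := (k + 1 : ℕ) * (G.len e / n)) (hmem k hk.le).1 (by
      rw [← sub_nonneg, hd]; positivity) (hmem (k + 1) hk).2 (h0 k hk)
  rwa [hd] at this

variable {p : ℝ} {W ρ : E → ℝ → ℝ} {a B Λ : ℝ}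

lemma integrableOn_quadForm (hp : 2 < p)
    (hW : ∀ e, MemLp (W e) ∞ (volume.restrict (Ioo 0 (G.len e))))
    (hρ : ∀ e, MemLp (ρ e) ∞ (volume.restrict (Ioo 0 (G.len e)))) (lam : ℝ) (u φ : G.H1) (e : E) :
    IntegrableOn (fun x => weakDeriv φ e x ^ 2 + (W e x + lam) * fn φ e x ^ 2 -
      (p - 1) * ρ e x * |fn u e x| ^ (p - 2) * fn φ e x ^ 2) (Ioo 0 (G.len e)) := by
  have hc : ContinuousOn (fun x => fn φ e x ^ 2) (Icc 0 (G.len e)) :=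
    ((continuous_fn φ e).pow 2).continuousOn
  have := ((integrableOn_weakDeriv_sq φ e).add (integrableOn_linear hW lam e hc)).sub
    ((integrableOn_nonlinear hp hρ u e hc).const_mul (p - 1))
  refine this.congr (.of_forall fun x => ?_)
  simp only [Pi.sub_apply, Pi.add_apply]
  ring

/-- The quadratic form is nonnegative on functions that vanish on a fine grid. -/
lemma quadForm_nonneg_of_grid [Fintype E] (hp : 2 < p)
    (hW : ∀ e, MemLp (W e) ∞ (volume.restrict (Ioo 0 (G.len e))))
    (hρ : ∀ e, MemLp (ρ e) ∞ (volume.restrict (Ioo 0 (G.len e))))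
    (hB : 0 ≤ B) (hcoeff : CoeffBounds G W ρ a B) {lam : ℝ} (hlam : |lam| ≤ Λ)
    {u φ : G.H1} {M : ℝ} (hM0 : 0 ≤ M) (hM : ∀ e, ∀ x ∈ Icc 0 (G.len e), |fn u e x| ≤ M)
    {n : ℕ} (hn : 0 < n)
    (hfine : ∀ e, (B + Λ + (p - 1) * B * M ^ (p - 2)) * (G.len e / n) ^ 2 ≤ 1)
    (h0 : ∀ e, ∀ k < n, fn φ e (k * (G.len e / n)) = 0) :
    0 ≤ quadForm p W ρ lam u φ := by
  have hΛ : 0 ≤ Λ := (abs_nonneg _).trans hlam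
  refine Finset.sum_nonneg fun e _ => ?_
  set K := B + Λ + (p - 1) * B * M ^ (p - 2) with hK
  have hK0 : 0 ≤ K := by
    have : 0 ≤ p - 1 := by linarith
    positivity
  have hφ2 : IntegrableOn (fun x => fn φ e x ^ 2) (Ioo 0 (G.len e)) :=
    (((continuous_fn φ e).pow 2).continuousOn.integrableOn_compact isCompact_Icc).mono_set
      Ioo_subset_Icc_self
  have h1 : 0 ≤ ∫ x in Ioo 0 (G.len e), (weakDeriv φ e x ^ 2 - K * fn φ e x ^ 2) := by
    rw [integral_sub (integrableOn_weakDeriv_sq φ e) (hφ2.const_mul K), integral_const_mul]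
    have h2 := mul_le_mul_of_nonneg_left (integral_sq_le_of_grid φ e hn (h0 e)) hK0
    have h3 : 0 ≤ ∫ x in Ioo 0 (G.len e), weakDeriv φ e x ^ 2 :=
      integral_nonneg fun _ => sq_nonneg _
    have h4 := mul_le_mul_of_nonneg_right (hfine e) h3
    rw [mul_assoc, one_mul] at h4
    linarith
  refine h1.trans (integral_mono_ae ((integrableOn_weakDeriv_sq φ e).sub (hφ2.const_mul K))
    (integrableOn_quadForm hp hW hρ lam u φ e) ?_)
  filter_upwards [hcoeff e, ae_restrict_mem measurableSet_Ioo] with x hx hmem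
  have h1 : |fn u e x| ^ (p - 2) ≤ M ^ (p - 2) :=
    Real.rpow_le_rpow (abs_nonneg _) (hM e x ⟨hmem.1.le, hmem.2.le⟩) (by linarith)
  have h2 : -(B + Λ) ≤ W e x + lam := by
    linarith [(abs_le.mp hx.1).1, (abs_le.mp hlam).1]
  have h3 : ρ e x * |fn u e x| ^ (p - 2) ≤ B * M ^ (p - 2) :=
    mul_le_mul hx.2.2 h1 (by positivity) hB
  have h4 : (p - 1) * (ρ e x * |fn u e x| ^ (p - 2)) ≤ (p - 1) * (B * M ^ (p - 2)) :=
    mul_le_mul_of_nonneg_left h3 (by linarith)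
  have h5 : -K ≤ W e x + lam - (p - 1) * ρ e x * |fn u e x| ^ (p - 2) := by
    rw [hK]; linarith
  have h6 := mul_le_mul_of_nonneg_right h5 (sq_nonneg (fn φ e x))
  linarith

/-- The Morse index is bounded in terms of a bound on `|u|`. -/
theorem exists_morseIndex_le [Fintype E] (hp : 2 < p)
    (hW : ∀ e, MemLp (W e) ∞ (volume.restrict (Ioo 0 (G.len e))))
    (hρ : ∀ e, MemLp (ρ e) ∞ (volume.restrict (Ioo 0 (G.len e))))
    (hB : 0 ≤ B) (hcoeff : CoeffBounds G W ρ a B) (hΛ : 0 ≤ Λ) {M : ℝ}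
    (hM0 : 0 ≤ M) :
    ∃ N : ℕ, ∀ lam, |lam| ≤ Λ → ∀ u : G.H1, (∀ e, ∀ x ∈ Icc 0 (G.len e), |fn u e x| ≤ M) →
      morseIndex p W ρ lam u ≤ N := by
  set K := B + Λ + (p - 1) * B * M ^ (p - 2) with hK
  have hK0 : 0 ≤ K := by
    have : 0 ≤ p - 1 := by linarith
    positivity
  obtain ⟨L, hL⟩ := Finite.exists_le G.len
  obtain ⟨n, hn⟩ := exists_nat_ge (max 1 (L * (K + 1)))
  have hn1 : (1 : ℝ) ≤ n := (le_max_left _ _).trans hn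
  have hn0 : 0 < n := by exact_mod_cast one_pos.trans_le hn1
  have hfine : ∀ e, K * (G.len e / n) ^ 2 ≤ 1 := fun e => by
    have h1 : G.len e * (K + 1) ≤ n :=
      (mul_le_mul_of_nonneg_right (hL e) (by linarith)).trans ((le_max_right _ _).trans hn)
    have h2 : G.len e / n ≤ 1 / (K + 1) := by
      rw [div_le_div_iff₀ (by linarith) (by linarith)]; linarith
    have h3 : (G.len e / n) ^ 2 ≤ (1 / (K + 1)) ^ 2 :=
      pow_le_pow_left₀ (div_nonneg (G.len_pos e).le (by linarith)) h2 2
    refine (mul_le_mul_of_nonneg_left h3 hK0).trans ?_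
    rw [div_pow, one_pow, mul_one_div, div_le_one (by positivity)]
    nlinarith
  refine ⟨Fintype.card (E × Fin n), fun lam hlam u hu => iSup₂_le fun X hX => ?_⟩
  by_contra! hlt
  let T : G.H1 →ₗ[ℝ] (E × Fin n → ℝ) :=
    { toFun := fun φ i => fn φ i.1 ((i.2 : ℕ) * (G.len i.1 / n))
      map_add' := fun φ ψ => funext fun i => fn_add _ _ _ _
      map_smul' := fun c φ => funext fun i => fn_smul _ _ _ _ }
  obtain ⟨φ, hφX, hφ0, hφ⟩ := exists_mem_ne_zero_of_card_lt_finrank (M := G.H1) X T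
    (by exact_mod_cast hlt)
  refine (hX.2 φ hφX hφ0).not_ge ?_
  exact quadForm_nonneg_of_grid hp hW hρ hB hcoeff hlam hM0 hu hn0 hfine
    fun e k hk => congrFun hφ (e, ⟨k, hk⟩)

end MetricGraph

/-- The step function with value `c i` on the interval `(z i, z (i + 1)]`. -/
def stepFun {n : ℕ} (z : Fin (n + 1) → ℝ) (c : Fin n → ℝ) (x : ℝ) : ℝ :=
  ∑ i, (Ioc (z i.castSucc) (z i.succ)).indicator (fun _ => c i) x

lemma stepFun_add {n : ℕ} (z : Fin (n + 1) → ℝ) (c d : Fin n → ℝ) (x : ℝ) :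
    stepFun z (c + d) x = stepFun z c x + stepFun z d x := by
  simp only [stepFun, ← Finset.sum_add_distrib]
  refine Finset.sum_congr rfl fun i _ => ?_
  by_cases h : x ∈ Ioc (z i.castSucc) (z i.succ) <;> simp [h]

lemma stepFun_smul {n : ℕ} (z : Fin (n + 1) → ℝ) (a : ℝ) (c : Fin n → ℝ) (x : ℝ) :
    stepFun z (a • c) x = a * stepFun z c x := by
  simp only [stepFun, Finset.mul_sum]
  refine Finset.sum_congr rfl fun i _ => ?_
  by_cases h : x ∈ Ioc (z i.castSucc) (z i.succ) <;> simp [h]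

lemma stepFun_of_mem {n : ℕ} {z : Fin (n + 1) → ℝ} (hz : StrictMono z) (c : Fin n → ℝ) {x : ℝ}
    {i : Fin n} (hx : x ∈ Ioc (z i.castSucc) (z i.succ)) : stepFun z c x = c i := by
  rw [stepFun, Finset.sum_eq_single_of_mem i (Finset.mem_univ i), indicator_of_mem hx]
  intro j _ hj
  refine indicator_of_notMem (fun hxj => ?_) _
  rcases hj.lt_or_gt with h | h
  · exact (hxj.2.trans (hz.monotone (Fin.succ_le_castSucc_iff.mpr h))).not_gt hx.1
  · exact (hx.2.trans (hz.monotone (Fin.succ_le_castSucc_iff.mpr h))).not_gt hxj.1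

lemma stepFun_sq {n : ℕ} {z : Fin (n + 1) → ℝ} (hz : StrictMono z) (c : Fin n → ℝ) (x : ℝ) :
    stepFun z (c ^ 2) x = stepFun z c x ^ 2 := by
  by_cases h : ∃ i : Fin n, x ∈ Ioc (z i.castSucc) (z i.succ)
  · obtain ⟨i, hi⟩ := h
    rw [stepFun_of_mem hz _ hi, stepFun_of_mem hz _ hi, Pi.pow_apply]
  · push Not at h
    have h0 : ∀ d : Fin n → ℝ, stepFun z d x = 0 := fun d =>
      Finset.sum_eq_zero fun i _ => indicator_of_notMem (h i) _
    rw [h0, h0, zero_pow two_ne_zero]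

lemma memLp_stepFun_mul {n : ℕ} (z : Fin (n + 1) → ℝ) (c : Fin n → ℝ) {g : ℝ → ℝ}
    {q : ℝ≥0∞} {μ : Measure ℝ} (hg : MemLp g q μ) : MemLp (fun x => stepFun z c x * g x) q μ := by
  simp only [stepFun, Finset.sum_mul]
  refine memLp_finsetSum _ fun i _ => ?_
  have := (hg.const_mul (c i)).indicator (s := Ioc (z i.castSucc) (z i.succ)) measurableSet_Ioc
  refine this.ae_eq (.of_forall fun x => ?_)
  by_cases h : x ∈ Ioc (z i.castSucc) (z i.succ) <;> simp [h]

/-- Cutting a primitive off at two of its zeros. -/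
lemma indicator_mul_eq_integral {f g : ℝ → ℝ} {l r s x : ℝ} (hr : 0 ≤ r) (hrs : r ≤ s)
    (hs : s ≤ l) (hx : x ∈ Icc 0 l)
    (hf : ∀ x ∈ Icc 0 l, ∀ y ∈ Icc 0 l, f y - f x = ∫ t in x..y, g t)
    (hfr : f r = 0) (hfs : f s = 0) (c : ℝ) :
    (Ioc r s).indicator (fun _ => c) x * f x =
      ∫ t in (0 : ℝ)..x, (Ioc r s).indicator (fun _ => c) t * g t := by
  have e1 : (fun t => (Ioc r s).indicator (fun _ => c) t * g t) =
      (Ioc r s).indicator fun t => c * g t := by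
    ext t; by_cases h : t ∈ Ioc r s <;> simp [h]
  have hrm : r ∈ Icc 0 l := ⟨hr, hrs.trans hs⟩
  rw [e1, intervalIntegral.integral_of_le hx.1, setIntegral_indicator measurableSet_Ioc,
    Ioc_inter_Ioc, sup_eq_right.mpr hr, integral_const_mul]
  rcases le_or_gt x r with hxr | hxr
  · rw [indicator_of_notMem (fun h => h.1.not_ge hxr), Ioc_eq_empty (fun h =>
      (h.trans_le inf_le_left).not_ge hxr)]
    simp
  rcases le_or_gt x s with hxs | hxs
  · rw [indicator_of_mem (show x ∈ Ioc r s from ⟨hxr, hxs⟩), inf_eq_left.mpr hxs,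
      ← intervalIntegral.integral_of_le hxr.le, ← hf r hrm x hx, hfr, sub_zero]
  · rw [indicator_of_notMem (fun h => h.2.not_gt hxs), inf_eq_right.mpr hxs.le,
      ← intervalIntegral.integral_of_le hrs, ← hf r hrm s ⟨hr.trans hrs, hs⟩, hfr, hfs]
    simp

lemma stepFun_mul_eq_integral {n : ℕ} {z : Fin (n + 1) → ℝ} (hz : StrictMono z)
    (c : Fin n → ℝ) {f g : ℝ → ℝ} {l x : ℝ} (hzl : ∀ i, z i ∈ Icc 0 l) (hfz : ∀ i, f (z i) = 0)
    (hl : 0 ≤ l) (hg : IntegrableOn g (Ioo 0 l)) (hx : x ∈ Icc 0 l)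
    (hf : ∀ x ∈ Icc 0 l, ∀ y ∈ Icc 0 l, f y - f x = ∫ t in x..y, g t) :
    stepFun z c x * f x = ∫ t in (0 : ℝ)..x, stepFun z c t * g t := by
  simp only [stepFun, Finset.sum_mul]
  rw [intervalIntegral.integral_finsetSum]
  · exact Finset.sum_congr rfl fun i _ => indicator_mul_eq_integral (hzl _).1
      (hz (Fin.castSucc_lt_succ)).le (hzl _).2 hx hf (hfz _) (hfz _) _
  · intro i _
    refine intervalIntegrable_of_integrableOn_Ioo ?_ ⟨le_rfl, hl⟩ hx
    have := (hg.const_mul (c i)).indicator (s := Ioc (z i.castSucc) (z i.succ)) measurableSet_Ioc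
    refine this.congr (.of_forall fun x => ?_)
    by_cases h : x ∈ Ioc (z i.castSucc) (z i.succ) <;> simp [h]

lemma stepFun_mul_eq_zero {n : ℕ} {z : Fin (n + 1) → ℝ} (c : Fin n → ℝ) {f : ℝ → ℝ} {l : ℝ}
    (hzl : ∀ i, z i ∈ Icc 0 l) (hfz : ∀ i, f (z i) = 0) : stepFun z c l * f l = 0 := by
  rw [stepFun, Finset.sum_mul]
  refine Finset.sum_eq_zero fun i _ => ?_
  by_cases h : l ∈ Ioc (z i.castSucc) (z i.succ)
  · rw [le_antisymm h.2 (hzl i.succ).2, hfz, mul_zero]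
  · rw [indicator_of_notMem h, zero_mul]

namespace MetricGraph

variable {V E : Type*} {G : MetricGraph V E} {p : ℝ} {W ρ : E → ℝ → ℝ} {a B lam : ℝ} {u : G.H1}

/-- Multiplying `u` on an edge by step functions that jump at zeros of `u` gives a linear family
of functions in `H¹(G)`. -/
lemma exists_stepFun_linearMap (u : G.H1) (e : E) {n : ℕ} {z : Fin (n + 1) → ℝ}
    (hz : StrictMono z) (hzl : ∀ i, z i ∈ Icc 0 (G.len e)) (huz : ∀ i, fn u e (z i) = 0) :
    ∃ T : (Fin n → ℝ) →ₗ[ℝ] G.H1, ∀ c,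
      (∀ x ∈ Icc 0 (G.len e), fn (T c) e x = stepFun z c x * fn u e x) ∧
      (weakDeriv (T c) e =ᵐ[volume.restrict (Ioo 0 (G.len e))]
        fun x => stepFun z c x * weakDeriv u e x) ∧
      ∀ e' ≠ e, (∀ x, fn (T c) e' x = 0) ∧
        weakDeriv (T c) e' =ᵐ[volume.restrict (Ioo 0 (G.len e'))] 0 := by
  choose T hT hT' hTe using fun c : Fin n → ℝ => exists_H1_single (G := G) e
    (f := fun x => stepFun z c x * fn u e x) (g := fun x => stepFun z c x * weakDeriv u e x)
    (memLp_stepFun_mul z c (memLp_weakDeriv u e))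
    (fun x hx => stepFun_mul_eq_integral hz c hzl huz (G.len_pos e).le
      (integrableOn_weakDeriv u e) hx fun x hx y hy => fn_sub_fn u e hx hy)
    (stepFun_mul_eq_zero c hzl huz)
  refine ⟨⟨⟨T, fun c d => H1_ext fun e' x hx => ?_⟩, fun c d => H1_ext fun e' x hx => ?_⟩,
    fun c => ⟨hT c, hT' c, hTe c⟩⟩
  · by_cases he : e' = e
    · subst he
      rw [fn_add, hT _ x hx, hT _ x hx, hT _ x hx, stepFun_add, add_mul]
    · rw [fn_add, (hTe _ e' he).1, (hTe _ e' he).1, (hTe _ e' he).1, add_zero]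
  · by_cases he : e' = e
    · subst he
      rw [RingHom.id_apply, fn_smul, hT _ x hx, hT _ x hx, stepFun_smul, mul_assoc]
    · rw [RingHom.id_apply, fn_smul, (hTe _ e' he).1, (hTe _ e' he).1, mul_zero]

lemma quadForm_of_single [Fintype E] {e : E} {φ : G.H1} (hφ : ∀ e' ≠ e, (∀ x, fn φ e' x = 0) ∧
    weakDeriv φ e' =ᵐ[volume.restrict (Ioo 0 (G.len e'))] 0) :
    quadForm p W ρ lam u φ = ∫ x in Ioo 0 (G.len e),
      (weakDeriv φ e x ^ 2 + (W e x + lam) * fn φ e x ^ 2 -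
        (p - 1) * ρ e x * |fn u e x| ^ (p - 2) * fn φ e x ^ 2) := by
  refine Finset.sum_eq_single_of_mem e (Finset.mem_univ e) fun e' _ he => ?_
  refine integral_eq_zero_of_ae ?_
  filter_upwards [(hφ e' he).2] with x hx
  simp [(hφ e' he).1, hx]

/-- If `φ = σ u` and `ψ = σ² u` on an edge, for a step function `σ` that jumps at zeros of `u`,
then the quadratic form at `φ` can be computed by testing the equation with `ψ`. -/
lemma IsSolution.quadForm_eq [Fintype E] (hp : 2 < p)
    (hW : ∀ e, MemLp (W e) ∞ (volume.restrict (Ioo 0 (G.len e))))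
    (hρ : ∀ e, MemLp (ρ e) ∞ (volume.restrict (Ioo 0 (G.len e))))
    (h : IsSolution p W ρ lam u) {e : E} {φ ψ : G.H1} {σ : ℝ → ℝ}
    (hφ : ∀ x ∈ Icc 0 (G.len e), fn φ e x = σ x * fn u e x)
    (hφ' : weakDeriv φ e =ᵐ[volume.restrict (Ioo 0 (G.len e))] fun x => σ x * weakDeriv u e x)
    (hφe : ∀ e' ≠ e, (∀ x, fn φ e' x = 0) ∧
      weakDeriv φ e' =ᵐ[volume.restrict (Ioo 0 (G.len e'))] 0)
    (hψ : ∀ x ∈ Icc 0 (G.len e), fn ψ e x = σ x ^ 2 * fn u e x)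
    (hψ' : weakDeriv ψ e =ᵐ[volume.restrict (Ioo 0 (G.len e))] fun x => σ x ^ 2 * weakDeriv u e x)
    (hψe : ∀ e' ≠ e, (∀ x, fn ψ e' x = 0) ∧
      weakDeriv ψ e' =ᵐ[volume.restrict (Ioo 0 (G.len e'))] 0) :
    quadForm p W ρ lam u φ =
      -(p - 2) * ∫ x in Ioo 0 (G.len e), ρ e x * |fn u e x| ^ (p - 2) * fn φ e x ^ 2 := by
  have hφc : ContinuousOn (fun x => fn φ e x ^ 2) (Icc 0 (G.len e)) :=
    ((continuous_fn φ e).pow 2).continuousOn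
  have hL := integrableOn_linear hW lam e hφc
  have hN := integrableOn_nonlinear hp hρ u e hφc
  have key := h.edge e hψe
  have e1 : ∫ x in Ioo 0 (G.len e),
      (weakDeriv u e x * weakDeriv ψ e x + (W e x + lam) * fn u e x * fn ψ e x) =
      ∫ x in Ioo 0 (G.len e), (weakDeriv φ e x ^ 2 + (W e x + lam) * fn φ e x ^ 2) := by
    refine integral_congr_ae ?_
    filter_upwards [hφ', hψ', ae_restrict_mem measurableSet_Ioo] with x h1 h2 hx
    rw [h1, h2, hφ x ⟨hx.1.le, hx.2.le⟩, hψ x ⟨hx.1.le, hx.2.le⟩]; ring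
  have e2 : ∫ x in Ioo 0 (G.len e), ρ e x * |fn u e x| ^ (p - 2) * fn u e x * fn ψ e x =
      ∫ x in Ioo 0 (G.len e), ρ e x * |fn u e x| ^ (p - 2) * fn φ e x ^ 2 := by
    refine setIntegral_congr_fun measurableSet_Ioo fun x hx => ?_
    simp only [hφ x ⟨hx.1.le, hx.2.le⟩, hψ x ⟨hx.1.le, hx.2.le⟩]; ring
  rw [e1, e2] at key
  rw [quadForm_of_single hφe]
  have e3 : ∫ x in Ioo 0 (G.len e), (weakDeriv φ e x ^ 2 + (W e x + lam) * fn φ e x ^ 2 -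
      (p - 1) * ρ e x * |fn u e x| ^ (p - 2) * fn φ e x ^ 2) =
      (∫ x in Ioo 0 (G.len e), (weakDeriv φ e x ^ 2 + (W e x + lam) * fn φ e x ^ 2)) -
        (p - 1) * ∫ x in Ioo 0 (G.len e), ρ e x * |fn u e x| ^ (p - 2) * fn φ e x ^ 2 := by
    have hA : IntegrableOn (fun x => weakDeriv φ e x ^ 2 + (W e x + lam) * fn φ e x ^ 2)
        (Ioo 0 (G.len e)) := (integrableOn_weakDeriv_sq φ e).add hL
    rw [← integral_const_mul, ← integral_sub hA (hN.const_mul _)]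
    congr 1; ext x; ring
  rw [e3, key]; ring

lemma integral_nonlinear_pos (hp : 2 < p)
    (hρ : ∀ e, MemLp (ρ e) ∞ (volume.restrict (Ioo 0 (G.len e))))
    (ha : 0 < a) (hcoeff : CoeffBounds G W ρ a B) {e : E} {φ : G.H1}
    (hne : ∃ x ∈ Icc 0 (G.len e), fn u e x ≠ 0 ∧ fn φ e x ≠ 0) :
    0 < ∫ x in Ioo 0 (G.len e), ρ e x * |fn u e x| ^ (p - 2) * fn φ e x ^ 2 := by
  have hφc : ContinuousOn (fun x => fn φ e x ^ 2) (Icc 0 (G.len e)) :=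
    ((continuous_fn φ e).pow 2).continuousOn
  have hnn : 0 ≤ᵐ[volume.restrict (Ioo 0 (G.len e))]
      fun x => ρ e x * |fn u e x| ^ (p - 2) * fn φ e x ^ 2 := by
    filter_upwards [hcoeff e] with x hx
    have := ha.le.trans hx.2.1
    simp only [Pi.zero_apply]
    positivity
  refine (integral_nonneg_of_ae hnn).lt_of_ne fun h0 => ?_
  have hz := (integral_eq_zero_iff_of_nonneg_ae hnn
    (integrableOn_nonlinear hp hρ u e hφc)).mp h0.symm
  have hc : Continuous fun x => |fn u e x| ^ (p - 2) * fn φ e x ^ 2 :=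
    (continuous_abs_fn_rpow hp u e).mul ((continuous_fn φ e).pow 2)
  have hae : (fun x => |fn u e x| ^ (p - 2) * fn φ e x ^ 2)
      =ᵐ[volume.restrict (Icc 0 (G.len e))] fun _ => 0 := by
    rw [← restrict_Ioo_eq_restrict_Icc]
    filter_upwards [hz, hcoeff e] with x hx hcx
    rw [Pi.zero_apply, mul_assoc] at hx
    exact (mul_eq_zero.mp hx).resolve_left (ha.trans_le hcx.2.1).ne'
  obtain ⟨x, hx, hux, hφx⟩ := hne
  have := Measure.eqOn_Icc_of_ae_eq volume (G.len_pos e).ne hae hc.continuousOn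
    continuousOn_const hx
  have h1 : 0 < |fn u e x| ^ (p - 2) := Real.rpow_pos_of_pos (abs_pos.mpr hux) _
  have h2 : 0 < fn φ e x ^ 2 := by positivity
  exact (mul_pos h1 h2).ne' this

/-- The Morse index is at least the number of intervals between simple zeros on an edge. -/
theorem IsSolution.le_morseIndex [Fintype E] (hp : 2 < p)
    (hW : ∀ e, MemLp (W e) ∞ (volume.restrict (Ioo 0 (G.len e))))
    (hρ : ∀ e, MemLp (ρ e) ∞ (volume.restrict (Ioo 0 (G.len e))))
    (ha : 0 < a) (hcoeff : CoeffBounds G W ρ a B) (h : IsSolution p W ρ lam u) {e : E}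
    {g : ℝ → ℝ}
    (hg : ∀ x ∈ Icc 0 (G.len e), HasDerivWithinAt (fn u e) (g x) (Icc 0 (G.len e)) x)
    {n : ℕ} {s : Finset ℝ} (hs : s.card = n + 1)
    (hsz : ∀ z ∈ s, z ∈ Icc 0 (G.len e) ∧ fn u e z = 0 ∧ g z ≠ 0) :
    (n : ℕ∞) ≤ morseIndex p W ρ lam u := by
  set z := s.orderEmbOfFin hs
  have hz : StrictMono z := z.strictMono
  have hzs : ∀ i, z i ∈ s := s.orderEmbOfFin_mem hs
  obtain ⟨T, hT⟩ := exists_stepFun_linearMap u e hz (fun i => (hsz _ (hzs i)).1)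
    fun i => (hsz _ (hzs i)).2.1
  have hne : ∀ c ≠ 0, ∃ x ∈ Icc 0 (G.len e), fn u e x ≠ 0 ∧ fn (T c) e x ≠ 0 := by
    intro c hc
    obtain ⟨i, hi⟩ := Function.ne_iff.mp hc
    obtain ⟨hl, hl0, hlg⟩ := hsz _ (hzs i.castSucc)
    have hr := (hsz _ (hzs i.succ)).1
    have hlt : z i.castSucc < z i.succ := hz Fin.castSucc_lt_succ
    by_contra! hcon
    have hu0 : ∀ x ∈ Icc (z i.castSucc) (z i.succ), fn u e x = 0 := by
      intro x hx
      rcases hx.1.eq_or_lt with heq | hlx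
      · rw [← heq, hl0]
      by_contra hux
      have hxm : x ∈ Icc 0 (G.len e) := ⟨hl.1.trans hx.1, hx.2.trans hr.2⟩
      have := hcon x hxm hux
      rw [(hT c).1 x hxm, stepFun_of_mem hz c ⟨hlx, hx.2⟩] at this
      exact mul_ne_zero hi hux this
    have hmem : z i.castSucc ∈ Icc (z i.castSucc) (z i.succ) := ⟨le_rfl, hlt.le⟩
    have h1 := (hg _ hl).mono (Icc_subset_Icc hl.1 hr.2)
    have h2 : HasDerivWithinAt (fn u e) 0 (Icc (z i.castSucc) (z i.succ)) (z i.castSucc) :=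
      (hasDerivWithinAt_const _ _ 0).congr hu0 hl0
    exact hlg ((uniqueDiffOn_Icc hlt _ hmem).eq_deriv _ h1 h2)
  have hinj : Function.Injective T := by
    rw [← LinearMap.ker_eq_bot, LinearMap.ker_eq_bot']
    intro c hc
    by_contra hc0
    obtain ⟨x, -, -, hx⟩ := hne c hc0
    exact hx (by rw [hc, fn_zero])
  refine le_iSup₂_of_le (LinearMap.range T) ⟨inferInstance, ?_⟩ ?_
  · rintro _ ⟨c, rfl⟩ hc
    have hc0 : c ≠ 0 := fun h0 => hc (by rw [h0, map_zero])
    obtain ⟨h1, h2, h3⟩ := hT c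
    obtain ⟨k1, k2, k3⟩ := hT (c ^ 2)
    simp only [stepFun_sq hz] at k1 k2
    rw [h.quadForm_eq hp hW hρ h1 h2 h3 k1 k2 k3]
    exact mul_neg_of_neg_of_pos (by linarith)
      (integral_nonlinear_pos hp hρ ha hcoeff (hne c hc0))
  · rw [LinearMap.finrank_range_of_inj hinj, Module.finrank_fin_fun]

end MetricGraph

namespace MetricGraph

variable {V E : Type*} {G : MetricGraph V E} {p : ℝ} {W ρ : E → ℝ → ℝ} {a B Λ : ℝ}

/-- Solutions with small Morse index are bounded. -/
theorem exists_abs_fn_le_of_morseIndex_le [Fintype E] (hp : 2 < p)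
    (hW : ∀ e, MemLp (W e) ∞ (volume.restrict (Ioo 0 (G.len e))))
    (hρ : ∀ e, MemLp (ρ e) ∞ (volume.restrict (Ioo 0 (G.len e))))
    (ha : 0 < a) (hB : 0 ≤ B) (hcoeff : CoeffBounds G W ρ a B) (hΛ : 0 ≤ Λ) (m : ℕ) :
    ∃ M : ℝ, 0 ≤ M ∧ ∀ lam, |lam| ≤ Λ → ∀ u : G.H1, IsSolution p W ρ lam u →
      morseIndex p W ρ lam u ≤ m → ∀ e, ∀ x ∈ Icc 0 (G.len e), |fn u e x| ≤ M := by
  choose A hA using fun e => IsRestoringPair.exists_zeros (κ₀ := restoringLevel p a B Λ)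
    (sourceBound_nonneg hB hΛ p) (G.len_pos e) (m + 2)
  obtain ⟨M, hM⟩ := Finite.exists_le A
  refine ⟨max 0 M, le_max_left _ _, fun lam hlam u hu hm e x hx => ?_⟩
  by_contra! hlt
  obtain ⟨g, hg⟩ := hu.exists_isRestoringPair hp hW hρ ha hB hcoeff hlam e
  obtain ⟨s, hs, hsz⟩ := hA e _ g hg x hx
    (((hM e).trans (le_max_right _ _)).trans_lt hlt)
  have h1 := (hu.le_morseIndex hp hW hρ ha hcoeff hg.hasDeriv (n := m + 1) hs hsz).trans hm
  have h2 : m + 1 ≤ m := by exact_mod_cast h1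
  omega

lemma iSup_normC1_lt_top [Fintype E] (hp : 2 < p)
    (hW : ∀ e, MemLp (W e) ∞ (volume.restrict (Ioo 0 (G.len e))))
    (hρ : ∀ e, MemLp (ρ e) ∞ (volume.restrict (Ioo 0 (G.len e))))
    (ha : 0 < a) (hB : 0 ≤ B) (hcoeff : CoeffBounds G W ρ a B) {U : Set (ℝ × G.H1)}
    (hU : ∀ q ∈ U, |q.1| ≤ Λ ∧ IsSolution p W ρ q.1 q.2) {M : ℝ}
    (hM : ∀ q ∈ U, ∀ e, ∀ x ∈ Icc 0 (G.len e), |fn q.2 e x| ≤ M) :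
    (⨆ q ∈ U, ⨆ e, normC1 q.2 e) < ⊤ := by
  obtain ⟨N, hN⟩ := Finite.exists_le fun e => 2 * M / G.len e + sourceBound p B Λ M * G.len e
  have hle : ∀ q ∈ U, (⨆ e, normC1 q.2 e) ≤ ENNReal.ofReal M + ENNReal.ofReal N :=
    fun q hq => iSup_le fun e =>
      ((hU q hq).2.normC1_le hp hW hρ ha hB hcoeff (hU q hq).1 (hM q hq e)).trans
        (add_le_add_right (ENNReal.ofReal_le_ofReal (hN e)) _)
  exact (iSup₂_le hle).trans_lt
    (ENNReal.add_lt_top.mpr ⟨ENNReal.ofReal_lt_top, ENNReal.ofReal_lt_top⟩)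

lemma abs_fn_le_of_iSup_normLinfty_lt_top {U : Set (ℝ × G.H1)}
    (h : (⨆ q ∈ U, normLinfty q.2) < ⊤) :
    ∃ M : ℝ, 0 ≤ M ∧ ∀ q ∈ U, ∀ e, ∀ x ∈ Icc 0 (G.len e), |fn q.2 e x| ≤ M := by
  refine ⟨_, ENNReal.toReal_nonneg, fun q hq e x hx =>
    abs_fn_le_of_normLinfty_le q.2 h.ne ?_ e hx⟩
  exact le_iSup₂ (f := fun (q : ℝ × G.H1) (_ : q ∈ U) => normLinfty q.2) q hq

lemma morseIndex_lt_top [Fintype E] (hp : 2 < p)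
    (hW : ∀ e, MemLp (W e) ∞ (volume.restrict (Ioo 0 (G.len e))))
    (hρ : ∀ e, MemLp (ρ e) ∞ (volume.restrict (Ioo 0 (G.len e))))
    (hB : 0 ≤ B) (hcoeff : CoeffBounds G W ρ a B) (lam : ℝ) (u : G.H1) :
    morseIndex p W ρ lam u < ⊤ := by
  choose M hM0 hM using exists_abs_fn_le u
  obtain ⟨M', hM'⟩ := Finite.exists_le M
  obtain ⟨N, hN⟩ := exists_morseIndex_le hp hW hρ hB hcoeff (abs_nonneg lam) (le_max_left 0 M')
  have := hN lam le_rfl u fun e x hx =>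
      (hM e x hx).trans ((hM' e).trans (le_max_right _ _))
  exact this.trans_lt (ENat.natCast_lt_top N)

lemma iSup_morseIndex_lt_top [Fintype E] (hp : 2 < p)
    (hW : ∀ e, MemLp (W e) ∞ (volume.restrict (Ioo 0 (G.len e))))
    (hρ : ∀ e, MemLp (ρ e) ∞ (volume.restrict (Ioo 0 (G.len e))))
    (hB : 0 ≤ B) (hcoeff : CoeffBounds G W ρ a B) (hΛ : 0 ≤ Λ) {U : Set (ℝ × G.H1)}
    (hU : ∀ q ∈ U, |q.1| ≤ Λ) {M : ℝ} (hM0 : 0 ≤ M)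
    (hM : ∀ q ∈ U, ∀ e, ∀ x ∈ Icc 0 (G.len e), |fn q.2 e x| ≤ M) :
    (⨆ q ∈ U, morseIndex p W ρ q.1 q.2) < ⊤ := by
  obtain ⟨N, hN⟩ := exists_morseIndex_le hp hW hρ hB hcoeff hΛ hM0
  have hle : ∀ q ∈ U, morseIndex p W ρ q.1 q.2 ≤ N := fun q hq => hN q.1 (hU q hq) q.2 (hM q hq)
  exact (iSup₂_le hle).trans_lt (ENat.natCast_lt_top N)

lemma abs_fn_le_of_iSup_morseIndex_lt_top [Fintype E] (hp : 2 < p)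
    (hW : ∀ e, MemLp (W e) ∞ (volume.restrict (Ioo 0 (G.len e))))
    (hρ : ∀ e, MemLp (ρ e) ∞ (volume.restrict (Ioo 0 (G.len e))))
    (ha : 0 < a) (hB : 0 ≤ B) (hcoeff : CoeffBounds G W ρ a B) (hΛ : 0 ≤ Λ)
    {U : Set (ℝ × G.H1)} (hU : ∀ q ∈ U, |q.1| ≤ Λ ∧ IsSolution p W ρ q.1 q.2)
    (h : (⨆ q ∈ U, morseIndex p W ρ q.1 q.2) < ⊤) :
    ∃ M : ℝ, ∀ q ∈ U, ∀ e, ∀ x ∈ Icc 0 (G.len e), |fn q.2 e x| ≤ M := by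
  obtain ⟨m, hm⟩ := ENat.ne_top_iff_exists.mp h.ne
  obtain ⟨M, -, hM⟩ := exists_abs_fn_le_of_morseIndex_le hp hW hρ ha hB hcoeff hΛ m
  refine ⟨M, fun q hq => hM q.1 (hU q hq).1 q.2 (hU q hq).2 ?_⟩
  rw [hm]
  exact le_iSup₂ (f := fun (q : ℝ × G.H1) (_ : q ∈ U) => morseIndex p W ρ q.1 q.2) q hq

end MetricGraph

end

theorem mainTheorem9 {V E : Type*} [Fintype E] (G : MetricGraph V E)
    (p : ℝ) (hp : 2 < p) (W ρ : E → ℝ → ℝ)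
    (hW : ∀ e, MemLp (W e) ∞ (volume.restrict (Ioo 0 (G.len e))))
    (hρ : ∀ e, MemLp (ρ e) ∞ (volume.restrict (Ioo 0 (G.len e))))
    (hinf : ∃ a > 0, ∀ e, ∀ᵐ x ∂(volume.restrict (Ioo 0 (G.len e))), a ≤ ρ e x)
    (Λ : ℝ) (hΛ : 0 < Λ) (U : Set (ℝ × G.H1))
    (hU : ∀ q ∈ U, q.1 ∈ Icc (-Λ) Λ ∧ MetricGraph.IsSolution p W ρ q.1 q.2) :
    (∀ q ∈ U, ∀ e, ContDiffOn ℝ 1 (MetricGraph.fn q.2 e) (Icc 0 (G.len e))) ∧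
    (∀ q ∈ U, MetricGraph.morseIndex p W ρ q.1 q.2 < ⊤) ∧
    ((⨆ q ∈ U, MetricGraph.normLinfty q.2) < ⊤ ↔
      (⨆ q ∈ U, ⨆ e, MetricGraph.normC1 q.2 e) < ⊤) ∧
    ((⨆ q ∈ U, ⨆ e, MetricGraph.normC1 q.2 e) < ⊤ ↔
      (⨆ q ∈ U, MetricGraph.morseIndex p W ρ q.1 q.2) < ⊤) := by
  obtain ⟨a, ha, B, hB, hcoeff⟩ := MetricGraph.exists_coeffBounds hW hρ hinf
  have hU' : ∀ q ∈ U, |q.1| ≤ Λ ∧ MetricGraph.IsSolution p W ρ q.1 q.2 := fun q hq =>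
    ⟨abs_le.mpr (hU q hq).1, (hU q hq).2⟩
  have hLinf_of_C1 (h : (⨆ q ∈ U, ⨆ e, MetricGraph.normC1 q.2 e) < ⊤) :
      (⨆ q ∈ U, MetricGraph.normLinfty q.2) < ⊤ :=
    lt_of_le_of_lt (iSup₂_mono fun q _ => MetricGraph.normLinfty_le_normC1 q.2) h
  have hreg : ∀ q ∈ U, ∀ e, ContDiffOn ℝ 1 (MetricGraph.fn q.2 e) (Icc 0 (G.len e)) :=
    fun q hq e => (hU q hq).2.contDiffOn hp hW hρ e
  have hindex : ∀ q ∈ U, MetricGraph.morseIndex p W ρ q.1 q.2 < ⊤ := fun q _ =>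
    MetricGraph.morseIndex_lt_top hp hW hρ hB hcoeff q.1 q.2
  refine ⟨hreg, hindex, ⟨fun h => ?_, hLinf_of_C1⟩, ⟨fun h => ?_, fun h => ?_⟩⟩
  · obtain ⟨M, -, hM⟩ := MetricGraph.abs_fn_le_of_iSup_normLinfty_lt_top h
    exact MetricGraph.iSup_normC1_lt_top hp hW hρ ha hB hcoeff hU' hM
  · obtain ⟨M, hM0, hM⟩ := MetricGraph.abs_fn_le_of_iSup_normLinfty_lt_top (hLinf_of_C1 h)
    exact MetricGraph.iSup_morseIndex_lt_top hp hW hρ hB hcoeff hΛ.le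
      (fun q hq => (hU' q hq).1) hM0 hM
  · obtain ⟨M, hM⟩ := MetricGraph.abs_fn_le_of_iSup_morseIndex_lt_top hp hW hρ ha hB hcoeff
      hΛ.le hU' h
    exact MetricGraph.iSup_normC1_lt_top hp hW hρ ha hB hcoeff hU' hM
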